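/- Let $k$ be a field, let $p$ be a prime number with $\operatorname{char} k\neq p$, and let $l,d\ge 0$ be integers. Let $G$ be a cyclic group of order $p^l$ acting by $k$-algebra automorphisms on the power series ring $k[[x_1,\dots,x_d]]$, and let $S=k[[x_1,\dots,x_d]]^G$ be the ring of invariants. Let $D$ be a dualizing module for $S$, that is, a finitely generated $S$-module of finite injective dimension such that the homothety map $S\to\operatorname{Hom}_S(D,D)$ is an isomorphism and $\operatorname{Ext}^i_S(D,D)=0$ for all $i>0$. Let $M$ be a reflexive $S$-module of rank $1$ (the natural map $M\to\operatorname{Hom}_S(\operatorname{Hom}_S(M,S),S)$ is an isomorphism). If $M\otimes_S\operatorname{Hom}_S(M,D)$ is torsion-free, then $M$ is isomorphic to $S$ or to $D$. -/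

import Mathlib

universe u v

open CategoryTheory TensorProduct

/-- A semidualizing module over a commutative (Noetherian) ring `R`: a finitely generated module `C`
such that the homothety map `R → Hom_R(C, C)` is an isomorphism and `Ext^i_R(C, C) = 0` for all
`i > 0`. -/
structure IsSemidualizing (R : Type u) [CommRing R] (C : Type u) [AddCommGroup C] [Module R C] :
    Prop where
  finite : Module.Finite R C
  homothety_bijective : Function.Bijective (LinearMap.lsmul R C : R →ₗ[R] C →ₗ[R] C)
  ext_subsingleton : ∀ i : ℕ, 0 < i →
    Subsingleton (Abelian.Ext (ModuleCat.of R C) (ModuleCat.of R C) i)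

/-- A dualizing module over a commutative (Noetherian) ring `R`: a semidualizing module of finite
injective dimension. -/
structure IsDualizing (R : Type u) [CommRing R] (D : Type u) [AddCommGroup D] [Module R D] :
    Prop extends IsSemidualizing R D where
  finite_injectiveDimension : ∃ n : ℕ, HasInjectiveDimensionLE (ModuleCat.of R D) n

/-- The ring of invariants `k[[x₁, …, x_d]]^G` of a group `G` acting by `k`-algebra automorphisms
on the power series ring in `d` variables over `k`. -/
noncomputable abbrev powerSeriesInvariants (k : Type u) [Field k] (d : ℕ) (G : Type v) [Group G]
    [MulSemiringAction G (MvPowerSeries (Fin d) k)]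
    [SMulCommClass G k (MvPowerSeries (Fin d) k)] :
    Subalgebra k (MvPowerSeries (Fin d) k) :=
  FixedPoints.subalgebra k (MvPowerSeries (Fin d) k) G

/-! Write R for the power series ring. A generator of G acts on R through an automorphism τ of order
q = p^r, and S is the ring fixed by τ. Since R is factorial, M, D and Hom(M, D) can be replaced by
ideals I, J, N of S. The ideals I and N are cut out by their gcds in R, which can be chosen
semi-invariant: I = fR ∩ S with τf = af, and N = gR ∩ S with τg = bg (`exists_semiinvariant_gcd`).
Thus I and N are copies of the semi-invariants of weights a⁻¹ and b⁻¹.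

As q is invertible in k, τ is linear in suitable coordinates, and an eigenvector of its linear part
gives a formal curve on which τ acts as T ↦ ζT, with ζ a primitive q-th root of unity
(`exists_equivariant_curve`). Nonunit invariants restrict to multiples of T^q. Write the two weights
as ζ^t, ζ^t' with t, t' < q. If t ≤ t', there are semi-invariants u, v of weights a⁻¹ and b⁻¹/a⁻¹
whose product restricts to a nonzero multiple of T^t', so guv is a minimal generator of N
(`exists_semiinvariants_mul_notMem`).

Put X = fu and W = guv. Each Y = fy in I has a partner Z = gyv in N with XZ = YW, so
torsion-freeness gives X ⊗ Z = Y ⊗ W. As W is a minimal generator, this forces Y into SX + 𝔪I, and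
Nakayama gives I = SX (`eq_span_of_isTorsionFree_tensor`), that is M ≅ S. If t' ≤ t, the same
argument makes N principal. The single generator of Hom(I, J) is then an isomorphism, and M ≅ D. -/

namespace MvPowerSeries

/-! ### The maximal ideal of a power series ring and completeness -/

/-- A power series with zero constant coefficient lies in the ideal generated by the variables. -/
theorem mem_span_range_X_of_constantCoeff_eq_zero {σ A : Type*} [Finite σ] [CommRing A]
    {f : MvPowerSeries σ A} (hf : constantCoeff f = 0) :
    f ∈ Ideal.span (Set.range (X : σ → MvPowerSeries σ A)) := by
  classical
  cases nonempty_fintype σ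
  rcases isEmpty_or_nonempty σ with _ | _
  · have : f = 0 := by
      ext m
      rw [Subsingleton.elim m 0]
      simpa using hf
    exact this ▸ Ideal.zero_mem _
  have hsel : ∀ m : σ →₀ ℕ, m ≠ 0 → ∃ i, m i ≠ 0 := fun m hm => by
    by_contra! h
    exact hm (Finsupp.ext h)
  choose! sel hs using hsel
  -- `sel` assigns each nonconstant monomial to one variable dividing it; `g i` collects the terms
  -- assigned to `i`, divided by `X i`.
  let g : σ → MvPowerSeries σ A := fun i m =>
    if sel (m + Finsupp.single i 1) = i then coeff (m + Finsupp.single i 1) f else 0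
  have hg : ∀ i m, coeff m (g i) =
      if sel (m + Finsupp.single i 1) = i then coeff (m + Finsupp.single i 1) f else 0 :=
    fun _ _ => rfl
  have key : f = ∑ i, g i * X i := by
    ext m
    rw [map_sum]
    have hterm : ∀ i, coeff m (g i * X i) =
        if m i ≠ 0 ∧ sel m = i then coeff m f else 0 := by
      intro i
      rw [X, coeff_mul_monomial]
      by_cases hmi : m i = 0
      · rw [if_neg, if_neg]
        · simp [hmi]
        · intro h
          have := h i
          simp [hmi] at this
      · have hle : Finsupp.single i 1 ≤ m := by
          rw [Finsupp.single_le_iff]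
          omega
        rw [if_pos hle, hg, tsub_add_cancel_of_le hle]
        simp [hmi]
    simp_rw [hterm]
    by_cases hm : m = 0
    · subst hm
      simpa using hf
    · rw [Finset.sum_eq_single (sel m)]
      · simp [hs m hm]
      · intro b _ hb
        rw [if_neg]
        rintro ⟨_, h⟩
        exact hb h.symm
      · simp
  rw [key]
  exact Ideal.sum_mem _ fun i _ => Ideal.mul_mem_left _ _ (Ideal.subset_span ⟨i, rfl⟩)

theorem mem_span_range_X_iff {σ A : Type*} [Finite σ] [CommRing A] {f : MvPowerSeries σ A} :
    f ∈ Ideal.span (Set.range (X : σ → MvPowerSeries σ A)) ↔ constantCoeff f = 0 := by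
  refine ⟨fun h => ?_, mem_span_range_X_of_constantCoeff_eq_zero⟩
  have : Ideal.span (Set.range (X : σ → MvPowerSeries σ A)) ≤ RingHom.ker constantCoeff := by
    rw [Ideal.span_le]
    rintro _ ⟨i, rfl⟩
    simp
  exact this h

theorem maximalIdeal_eq_span_range_X {σ k : Type*} [Finite σ] [Field k] :
    IsLocalRing.maximalIdeal (MvPowerSeries σ k) = Ideal.span (Set.range X) := by
  ext f
  rw [mem_span_range_X_iff, IsLocalRing.mem_maximalIdeal, mem_nonunits_iff,
    isUnit_iff_constantCoeff, isUnit_iff_ne_zero, not_not]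

instance isAdicComplete_maximalIdeal {σ k : Type*} [Finite σ] [Field k] :
    IsAdicComplete (IsLocalRing.maximalIdeal (MvPowerSeries σ k)) (MvPowerSeries σ k) := by
  rw [maximalIdeal_eq_span_range_X]
  infer_instance

end MvPowerSeries

/-! ### Primality from Weierstrass preparation -/

namespace PowerSeries

/-- Over a complete local factorial domain, an irreducible power series whose reduction is nonzero
is prime. -/
theorem prime_of_irreducible_of_map_residue_ne_zero {A : Type*} [CommRing A] [IsDomain A]
    [IsLocalRing A] [UniqueFactorizationMonoid A] [IsAdicComplete (IsLocalRing.maximalIdeal A) A]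
    {g : PowerSeries A} (hg : Irreducible g) (hres : g.map (IsLocalRing.residue A) ≠ 0) :
    Prime g := by
  obtain ⟨f, h, H⟩ := g.exists_isWeierstrassFactorization hres
  have hmon := H.isDistinguishedAt.monic
  have hne1 : f ≠ 1 := by
    rintro rfl
    apply hg.not_isUnit
    rw [H.eq_mul]
    simpa using H.isUnit
  -- A monic factor of a distinguished polynomial reduces to a power of the variable. In positive
  -- degree its constant term lies in the maximal ideal, so it cannot be a unit as a power series.
  have hunit : ∀ a b : Polynomial A, a.Monic → b.Monic → a * b = f →
      IsUnit (a : PowerSeries A) → a.natDegree = 0 := by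
    intro a b ha hb hab hu
    have hmap := H.isDistinguishedAt.map_eq_X_pow
    rw [← hab, Polynomial.map_mul] at hmap
    have hdvd : a.map (Ideal.Quotient.mk (IsLocalRing.maximalIdeal A)) ∣
        Polynomial.X ^ (a * b).natDegree := ⟨_, hmap.symm⟩
    let _ : Field (A ⧸ IsLocalRing.maximalIdeal A) := Ideal.Quotient.field _
    obtain ⟨i, -, hi⟩ := (dvd_prime_pow Polynomial.prime_X _).1 hdvd
    have hXi := Polynomial.eq_of_monic_of_associated (ha.map _) (Polynomial.monic_X_pow i) hi
    rw [← ha.natDegree_map (Ideal.Quotient.mk (IsLocalRing.maximalIdeal A)), hXi,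
      Polynomial.natDegree_X_pow]
    by_contra hi0
    have h0 := congrArg (fun p => Polynomial.coeff p 0) hXi
    simp only [Polynomial.coeff_map, Polynomial.coeff_X_pow] at h0
    rw [if_neg (Ne.symm hi0), Ideal.Quotient.eq_zero_iff_mem] at h0
    have hu' := (isUnit_iff_constantCoeff (φ := (a : PowerSeries A))).1 hu
    rw [← coeff_zero_eq_constantCoeff_apply, Polynomial.coeff_coe] at hu'
    exact h0 hu'
  have hfirr : Irreducible f := by
    rw [hmon.irreducible_iff_natDegree]
    refine ⟨hne1, fun a b ha hb hab => ?_⟩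
    have hfac : g = (a : PowerSeries A) * ((b : PowerSeries A) * h) := by
      rw [H.eq_mul, ← hab, Polynomial.coe_mul, mul_assoc]
    rcases hg.isUnit_or_isUnit hfac with hu | hu
    · exact Or.inl (hunit a b ha hb hab hu)
    · exact Or.inr (hunit b a hb ha (by rw [mul_comm, hab]) (isUnit_of_mul_isUnit_left hu))
  -- Gauss's lemma makes `f` prime; Weierstrass division identifies the quotients by `f` and by `g`,
  -- so primality passes to `g`.
  have hfp : Prime f := hfirr.prime
  have h1 : (Ideal.span {f}).IsPrime := (Ideal.span_singleton_prime hfp.ne_zero).2 hfp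
  have : IsDomain (Polynomial A ⧸ Ideal.span {f}) := Ideal.Quotient.isDomain _
  have : IsDomain (PowerSeries A ⧸ Ideal.span {g}) :=
    H.algEquivQuotient.symm.toMulEquiv.isDomain (Polynomial A ⧸ Ideal.span {f})
  exact (Ideal.span_singleton_prime hg.ne_zero).1 ((Ideal.Quotient.isDomain_iff_prime _).1 this)

end PowerSeries

/-! ### Restriction to monomial curves and unique factorization -/

namespace MvPowerSeries

theorem exists_eq_C_add_sum {σ A : Type*} [Fintype σ] [CommRing A] (f : MvPowerSeries σ A) :
    ∃ g : σ → MvPowerSeries σ A, f = C (constantCoeff f) + ∑ i, g i * X i := by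
  have h := mem_span_range_X_of_constantCoeff_eq_zero (f := f - C (constantCoeff f)) (by simp)
  obtain ⟨g, hg⟩ := (Ideal.mem_span_range_iff_exists_fun).1 h
  exact ⟨g, by rw [hg]; ring⟩

/-- Two algebra homomorphisms which agree on the variables, with values there in an ideal `J`, agree
modulo all powers of `J`. -/
theorem algHom_sub_mem_pow {σ A B : Type*} [Finite σ] [CommRing A] [CommRing B] [Algebra A B]
    (φ ψ : MvPowerSeries σ A →ₐ[A] B) (J : Ideal B) (hX : ∀ i, φ (X i) = ψ (X i))
    (hJ : ∀ i, φ (X i) ∈ J) (N : ℕ) (f : MvPowerSeries σ A) : φ f - ψ f ∈ J ^ N := by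
  cases nonempty_fintype σ
  induction N generalizing f with
  | zero => simp
  | succ N ih =>
    obtain ⟨g, hg⟩ := exists_eq_C_add_sum f
    have hC : φ (C (constantCoeff f)) = ψ (C (constantCoeff f)) :=
      (φ.commutes _).trans (ψ.commutes _).symm
    have : φ f - ψ f = ∑ i, (φ (g i) - ψ (g i)) * φ (X i) := by
      rw [hg, map_add, map_add, hC, map_sum, map_sum, add_sub_add_left_eq_sub,
        ← Finset.sum_sub_distrib]
      refine Finset.sum_congr rfl fun i _ => ?_
      rw [map_mul, map_mul, ← hX]
      ring
    rw [this, pow_succ]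
    exact Ideal.sum_mem _ fun i _ => Ideal.mul_mem_mul (ih _) (hJ i)

/-- An algebra homomorphism between power series rings sending the variables to series without
constant term is determined by its values on the variables. -/
theorem algHom_ext_of_constantCoeff {σ τ A B : Type*} [Finite σ] [Finite τ] [CommRing A]
    [CommRing B] [Algebra A B] {φ ψ : MvPowerSeries σ A →ₐ[A] MvPowerSeries τ B}
    (hX : ∀ i, φ (X i) = ψ (X i)) (hJ : ∀ i, constantCoeff (φ (X i)) = 0) : φ = ψ := by
  ext1 f
  rw [← sub_eq_zero]
  refine IsHausdorff.haus (I := Ideal.span (Set.range (X : τ → MvPowerSeries τ B)))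
    inferInstance _ fun n => ?_
  rw [SModEq.zero, smul_eq_mul, Ideal.mul_top]
  exact algHom_sub_mem_pow φ ψ _ hX (fun i => mem_span_range_X_iff.2 (hJ i)) n f

theorem rename_succ_eq_finSuccEquiv_symm {k : Type*} [Field k] {n : ℕ}
    (g : MvPowerSeries (Fin n) k) :
    rename Fin.succ g = (finSuccEquiv k n).symm (PowerSeries.C g) := by
  let φ : MvPowerSeries (Fin n) k →ₐ[k] MvPowerSeries (Fin (n + 1)) k :=
    (finSuccEquiv k n).symm.toAlgHom.comp
      (IsScalarTower.toAlgHom k (MvPowerSeries (Fin n) k) (PowerSeries (MvPowerSeries (Fin n) k)))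
  have hφ : ∀ f, φ f = (finSuccEquiv k n).symm (PowerSeries.C f) := fun _ => rfl
  rw [← hφ]
  congr 1
  have hX : ∀ i : Fin n, rename (R := k) Fin.succ (X i) = X i.succ := fun i => rename_X _ _
  refine algHom_ext_of_constantCoeff (fun i => ?_) fun i => ?_
  · rw [hX, hφ, ← finSuccEquiv_X_succ, AlgEquiv.symm_apply_apply]
  · rw [hX, constantCoeff_X]

/-- Here `g` is the lowest nonzero coefficient with respect to the first variable. It allows
induction on the number of variables. -/
theorem exists_eq_rename_succ_add {k : Type*} [Field k] {n : ℕ} {f : MvPowerSeries (Fin (n + 1)) k}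
    (hf : f ≠ 0) : ∃ (j : ℕ) (g : MvPowerSeries (Fin n) k) (h : MvPowerSeries (Fin (n + 1)) k),
      g ≠ 0 ∧ f = X 0 ^ j * (rename Fin.succ g + X 0 * h) := by
  set F := finSuccEquiv k n f with hF
  have hF0 : F ≠ 0 := by simpa [hF] using hf
  obtain ⟨j, G, hG, hG0⟩ : ∃ (j : ℕ) (G : PowerSeries (MvPowerSeries (Fin n) k)),
      F = PowerSeries.X ^ j * G ∧ PowerSeries.constantCoeff G ≠ 0 := by
    refine ⟨F.order.toNat, PowerSeries.divXPowOrder F, ?_, ?_⟩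
    · exact PowerSeries.X_pow_order_mul_divXPowOrder.symm
    · rwa [Ne, PowerSeries.constantCoeff_divXPowOrder_eq_zero_iff]
  obtain ⟨H, hH⟩ := PowerSeries.X_dvd_iff.2
    (show PowerSeries.constantCoeff (G - PowerSeries.C (PowerSeries.constantCoeff G)) = 0 by simp)
  refine ⟨j, PowerSeries.constantCoeff G, (finSuccEquiv k n).symm H, hG0, ?_⟩
  apply (finSuccEquiv k n).injective
  rw [← hF, hG, map_mul, map_pow, finSuccEquiv_X_zero, map_add, rename_succ_eq_finSuccEquiv_symm,
    map_mul, finSuccEquiv_X_zero, AlgEquiv.apply_symm_apply, AlgEquiv.apply_symm_apply, ← hH]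
  ring

theorem hasSubst_X_pow {k : Type*} [Field k] {n : ℕ} {e : Fin n → ℕ} (he : ∀ i, e i ≠ 0) :
    HasSubst (fun i => (X () ^ e i : MvPowerSeries Unit k)) :=
  hasSubst_of_constantCoeff_zero fun i => by simp [he i]

/-- A nonzero power series restricts to a nonzero series on some monomial curve whose last
coordinate is the parameter. -/
theorem exists_subst_X_pow_ne_zero {k : Type*} [Field k] {n : ℕ} :
    ∀ {f : MvPowerSeries (Fin (n + 1)) k}, f ≠ 0 →
    ∃ e : Fin (n + 1) → ℕ, (∀ i, e i ≠ 0) ∧ e (Fin.last n) = 1 ∧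
      subst (fun i => (X () ^ e i : MvPowerSeries Unit k)) f ≠ 0 := by
  induction n with
  | zero =>
    intro f hf
    refine ⟨fun _ => 1, by simp, rfl, fun h => hf ?_⟩
    have hs := hasSubst_X_pow (k := k) (e := fun _ : Fin 1 => 1) (by simp)
    have hb : HasSubst (fun _ : Unit => (X 0 : MvPowerSeries (Fin 1) k)) :=
      hasSubst_of_constantCoeff_zero fun i => by simp
    have h2 := subst_comp_subst_apply hs hb f
    rw [h] at h2
    have h3 : (fun s : Fin 1 => subst (fun _ : Unit => (X 0 : MvPowerSeries (Fin 1) k))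
        ((X () ^ 1 : MvPowerSeries Unit k))) = X := by
      funext s
      rw [pow_one, subst_X hb, Subsingleton.elim s 0]
    rw [h3, subst_self] at h2
    rw [← substAlgHom_apply hb, map_zero] at h2
    exact h2.symm
  | succ n ih =>
    intro f hf
    obtain ⟨j, g, h, hg, rfl⟩ := exists_eq_rename_succ_add hf
    obtain ⟨e, he, hlast, hne⟩ := ih hg
    set G := subst (fun i => (X () ^ e i : MvPowerSeries Unit k)) g with hG
    -- With the first variable sent to the `N + 1`-st power of the parameter, the remaining terms
    -- are too divisible to cancel `G`.
    obtain ⟨N, hN⟩ : ∃ N : ℕ, ¬ (X () : MvPowerSeries Unit k) ^ (N + 1) ∣ G := by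
      by_contra! hall
      apply hne
      ext m
      exact PowerSeries.X_pow_dvd_iff.1 (hall m) m (Nat.lt_succ_self m)
    have he' : ∀ i, (Fin.cons (N + 1) e : Fin (n + 2) → ℕ) i ≠ 0 := by
      intro i
      refine Fin.cases ?_ (fun i => ?_) i
      · simp
      · simpa using he i
    have hs := hasSubst_X_pow (k := k) he'
    refine ⟨Fin.cons (N + 1) e, he', ?_, ?_⟩
    · rw [← Fin.succ_last, Fin.cons_succ, hlast]
    · rw [subst_mul hs, subst_pow hs, subst_add hs, subst_mul hs, subst_X hs]
      have hren : subst (fun i => (X () ^ (Fin.cons (N + 1) e : Fin (n + 2) → ℕ) i :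
          MvPowerSeries Unit k)) (rename Fin.succ g) = G := by
        rw [rename_eq_subst, subst_comp_subst_apply (HasSubst.X_comp _) hs, hG]
        congr 1
        funext s
        simp only [Function.comp]
        rw [subst_X hs, Fin.cons_succ]
      rw [hren, Fin.cons_zero]
      refine mul_ne_zero (pow_ne_zero _ (pow_ne_zero _ ?_)) fun h0 => hN ?_
      · intro h0
        have := congrArg (coeff (Finsupp.single () 1)) h0
        rw [coeff_index_single_self_X] at this
        simp at this
      · rw [eq_neg_of_add_eq_zero_left h0]
        exact (Dvd.intro _ rfl).neg_right

end MvPowerSeries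

namespace MvPowerSeries

/-- Reversing the variables moves the exponent 1 to `X 0`, the variable that `finSuccEquiv` singles
out. -/
theorem exists_subst_X_pow_ne_zero' {k : Type*} [Field k] {n : ℕ}
    {f : MvPowerSeries (Fin (n + 1)) k} (hf : f ≠ 0) :
    ∃ e : Fin (n + 1) → ℕ, (∀ i, e i ≠ 0) ∧ e 0 = 1 ∧
      subst (fun i => (X () ^ e i : MvPowerSeries Unit k)) f ≠ 0 := by
  have hr : renameEquiv k Fin.revPerm f ≠ 0 :=
    (renameEquiv k Fin.revPerm).map_ne_zero_iff.2 hf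
  obtain ⟨e, he, hlast, hne⟩ := exists_subst_X_pow_ne_zero hr
  refine ⟨fun i => e i.rev, fun i => he _, by simpa using hlast, ?_⟩
  have : renameEquiv k Fin.revPerm f = rename Fin.revPerm f := rfl
  rw [this, rename_eq_subst, subst_comp_subst_apply (HasSubst.X_comp _) (hasSubst_X_pow he)] at hne
  convert! hne using 3 with s
  simp only [Function.comp]
  rw [subst_X (hasSubst_X_pow he)]
  rfl

/-- The automorphism `x₀ ↦ x₀`, `xᵢ ↦ xᵢ + c x₀ ^ eᵢ` as a family of power series. -/
noncomputable def shear (k : Type*) [Field k] {n : ℕ} (e : Fin (n + 1) → ℕ) (c : k)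
    (i : Fin (n + 1)) : MvPowerSeries (Fin (n + 1)) k :=
  if i = 0 then X 0 else X i + C c * X 0 ^ e i

theorem constantCoeff_shear {k : Type*} [Field k] {n : ℕ} {e : Fin (n + 1) → ℕ}
    (he : ∀ i, e i ≠ 0) (c : k) (i : Fin (n + 1)) : constantCoeff (shear k e c i) = 0 := by
  unfold shear
  split_ifs <;> simp [he i]

theorem hasSubst_shear {k : Type*} [Field k] {n : ℕ} {e : Fin (n + 1) → ℕ}
    (he : ∀ i, e i ≠ 0) (c : k) : HasSubst (shear k e c) :=
  hasSubst_of_constantCoeff_zero (constantCoeff_shear he c)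

theorem subst_shear_shear {k : Type*} [Field k] {n : ℕ} {e : Fin (n + 1) → ℕ}
    (he : ∀ i, e i ≠ 0) (c : k) (f : MvPowerSeries (Fin (n + 1)) k) :
    subst (shear k e (-c)) (subst (shear k e c) f) = f := by
  rw [subst_comp_subst_apply (hasSubst_shear he c) (hasSubst_shear he (-c))]
  have : (fun s => subst (shear k e (-c)) (shear k e c s)) = X := by
    funext s
    have h0 : subst (shear k e (-c)) (X 0 : MvPowerSeries (Fin (n + 1)) k) = X 0 := by
      rw [subst_X (hasSubst_shear he _), shear, if_pos rfl]
    by_cases hs : s = 0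
    · subst hs
      rw [shear, if_pos rfl, h0]
    · rw [shear, if_neg hs, subst_add (hasSubst_shear he _), subst_mul (hasSubst_shear he _),
        subst_pow (hasSubst_shear he _), h0, subst_X (hasSubst_shear he _), subst_C, shear,
        if_neg hs, map_neg]
      ring
  rw [this, subst_self, id]

/-- The automorphism of the power series ring given by a shear. -/
noncomputable def shearEquiv {k : Type*} [Field k] {n : ℕ} {e : Fin (n + 1) → ℕ}
    (he : ∀ i, e i ≠ 0) : MvPowerSeries (Fin (n + 1)) k ≃ₐ[k] MvPowerSeries (Fin (n + 1)) k :=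
  AlgEquiv.ofAlgHom (substAlgHom (hasSubst_shear he 1)) (substAlgHom (hasSubst_shear he (-1)))
    (by ext1 f; simpa using subst_shear_shear he (-1) f)
    (by ext1 f; simpa using subst_shear_shear he 1 f)

/-- The shear straightens the monomial curve to the first axis. Nonvanishing on the curve thus
becomes the hypothesis of Weierstrass preparation. -/
theorem map_constantCoeff_finSuccEquiv_shear {k : Type*} [Field k] {n : ℕ} {e : Fin (n + 1) → ℕ}
    (he : ∀ i, e i ≠ 0) (h0 : e 0 = 1) (f : MvPowerSeries (Fin (n + 1)) k) :
    PowerSeries.map constantCoeff (finSuccEquiv k n (shearEquiv he f)) =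
      subst (fun i => (X () ^ e i : MvPowerSeries Unit k)) f := by
  let c : MvPowerSeries (Fin n) k →ₐ[k] k :=
    { (constantCoeff : MvPowerSeries (Fin n) k →+* k) with
      commutes' := fun r => constantCoeff_C r }
  let φ : MvPowerSeries (Fin (n + 1)) k →ₐ[k] MvPowerSeries Unit k :=
    (mapAlgHom c).comp ((finSuccEquiv k n).toAlgHom.comp (shearEquiv he).toAlgHom)
  have hφ : ∀ f, φ f = PowerSeries.map constantCoeff (finSuccEquiv k n (shearEquiv he f)) :=
    fun _ => rfl
  have hs : ∀ i, shearEquiv he (X i) = shear k e 1 i := fun i =>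
    substAlgHom_X (hasSubst_shear he 1) i
  rw [← hφ, ← substAlgHom_apply (hasSubst_X_pow he)]
  congr 1
  have hX : ∀ i, φ (X i) = X () ^ e i := by
    intro i
    rw [hφ, hs]
    refine Fin.cases ?_ (fun j => ?_) i
    · rw [shear, if_pos rfl, finSuccEquiv_X_zero, PowerSeries.map_X, h0, pow_one]
      rfl
    · rw [shear, if_neg (Fin.succ_ne_zero j), map_add, map_mul, map_pow, finSuccEquiv_X_zero,
        finSuccEquiv_X_succ, map_add, map_mul, map_pow, PowerSeries.map_X, PowerSeries.map_C,
        constantCoeff_X, map_one, map_one, map_one, map_zero, zero_add, one_mul]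
      rfl
  refine algHom_ext_of_constantCoeff (fun i => ?_) fun i => ?_
  · rw [hX, substAlgHom_X]
  · rw [hX]
    simp [he i]

instance isDomain_of_isDomain {σ A : Type*} [CommRing A] [IsDomain A] :
    IsDomain (MvPowerSeries σ A) :=
  NoZeroDivisors.to_isDomain _

/-- Factorizations exist by noetherianity. For primality, a shear makes the irreducible series
regular in the first variable, and Weierstrass preparation applies over the series in the other
variables, factorial by induction. -/
theorem uniqueFactorizationMonoid_fin (k : Type*) [Field k] (n : ℕ) :
    UniqueFactorizationMonoid (MvPowerSeries (Fin n) k) := by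
  induction n with
  | zero =>
    exact (isEmptyEquiv (σ := Fin 0) (R := k)).symm.toMulEquiv.uniqueFactorizationMonoid
      inferInstance
  | succ n ih =>
    have hprime : ∀ f : MvPowerSeries (Fin (n + 1)) k, Irreducible f → Prime f := by
      intro f hf
      obtain ⟨e, he, h0, hne⟩ := exists_subst_X_pow_ne_zero' hf.ne_zero
      rw [← map_constantCoeff_finSuccEquiv_shear he h0] at hne
      let E := (shearEquiv he).trans (finSuccEquiv k n)
      have hE : finSuccEquiv k n (shearEquiv he f) = E f := rfl
      rw [hE] at hne
      have hirr : Irreducible (E f) := (MulEquiv.irreducible_iff E.toMulEquiv).2 hf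
      have hp : Prime (E f) := by
        refine PowerSeries.prime_of_irreducible_of_map_residue_ne_zero hirr fun h => hne ?_
        ext m
        have hm := congrArg (PowerSeries.coeff m) h
        rw [PowerSeries.coeff_map, map_zero, IsLocalRing.residue_eq_zero_iff,
          maximalIdeal_eq_span_range_X, mem_span_range_X_iff] at hm
        rw [PowerSeries.coeff_map, hm, map_zero]
      exact (MulEquiv.prime_iff E.toMulEquiv).1 hp
    exact { (inferInstance : WfDvdMonoid (MvPowerSeries (Fin (n + 1)) k)) with
      irreducible_iff_prime := fun {f} => ⟨hprime f, Prime.irreducible⟩ }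

instance uniqueFactorizationMonoid (k : Type*) [Field k] (n : ℕ) :
    UniqueFactorizationMonoid (MvPowerSeries (Fin n) k) :=
  uniqueFactorizationMonoid_fin k n

end MvPowerSeries

/-! ### Linear parts of automorphisms and the formal inverse function theorem -/

namespace MvPowerSeries

section LinearPart

variable {σ k : Type*} [Field k]

/-- The coefficient of the variable `x_j`. -/
noncomputable def linCoeff (j : σ) : MvPowerSeries σ k →ₗ[k] k := coeff (Finsupp.single j 1)

theorem linCoeff_mul (j : σ) (f g : MvPowerSeries σ k) :
    linCoeff j (f * g) = constantCoeff f * linCoeff j g + linCoeff j f * constantCoeff g := by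
  classical
  rw [linCoeff, coeff_mul, Finsupp.antidiagonal_single]
  simp [Finset.Nat.antidiagonal_succ]

theorem linCoeff_C (j : σ) (c : k) : linCoeff j (C c : MvPowerSeries σ k) = 0 := by
  classical
  rw [linCoeff, coeff_C]
  simp

theorem linCoeff_X [DecidableEq σ] (i j : σ) :
    linCoeff j (X i : MvPowerSeries σ k) = (1 : Matrix σ σ k) i j := by
  classical
  rw [linCoeff, coeff_X, Matrix.one_apply]
  simp [Finsupp.single_left_inj, eq_comm]

theorem linCoeff_of_eq [Fintype σ] {f : MvPowerSeries σ k} {g : σ → MvPowerSeries σ k} {c : k}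
    (h : f = C c + ∑ i, g i * X i) (j : σ) : linCoeff j f = constantCoeff (g j) := by
  classical
  rw [h, map_add, linCoeff_C, map_sum, zero_add, Finset.sum_eq_single j]
  · rw [linCoeff_mul, linCoeff_X, constantCoeff_X]
    simp
  · intro b _ hb
    rw [linCoeff_mul, linCoeff_X, constantCoeff_X, Matrix.one_apply_ne hb]
    simp
  · simp

/-- An automorphism fixes the constants and preserves nonunits, and `f` minus its constant term is a
nonunit. -/
theorem constantCoeff_algEquiv (τ : MvPowerSeries σ k ≃ₐ[k] MvPowerSeries σ k)
    (f : MvPowerSeries σ k) : constantCoeff (τ f) = constantCoeff f := by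
  have h1 : ¬ IsUnit (f - C (constantCoeff f)) := by
    rw [isUnit_iff_constantCoeff]
    simp
  have h2 : ¬ IsUnit (τ (f - C (constantCoeff f))) := fun h =>
    h1 ((MulEquiv.isUnit_map τ).1 h)
  have hC : τ (C (constantCoeff f)) = C (constantCoeff f) := τ.commutes _
  rw [map_sub, hC, isUnit_iff_constantCoeff, isUnit_iff_ne_zero, not_not] at h2
  simpa [sub_eq_zero] using h2

/-- The matrix of the linear part of an automorphism. -/
noncomputable def linMatrix (τ : MvPowerSeries σ k ≃ₐ[k] MvPowerSeries σ k) : Matrix σ σ k :=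
  fun i j => linCoeff j (τ (X i))

theorem linCoeff_algEquiv [Fintype σ] (τ : MvPowerSeries σ k ≃ₐ[k] MvPowerSeries σ k) (j : σ)
    (f : MvPowerSeries σ k) : linCoeff j (τ f) = ∑ i, linCoeff i f * linMatrix τ i j := by
  obtain ⟨g, hg⟩ := exists_eq_C_add_sum f
  have hC : τ (C (constantCoeff f)) = C (constantCoeff f) := τ.commutes _
  have : τ f = C (constantCoeff f) + ∑ i, τ (g i) * τ (X i) := by
    conv_lhs => rw [hg]
    rw [map_add, map_sum, hC]
    simp_rw [map_mul]
  rw [this, map_add, linCoeff_C, zero_add, map_sum]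
  refine Finset.sum_congr rfl fun i _ => ?_
  rw [linCoeff_mul, constantCoeff_algEquiv, constantCoeff_algEquiv, constantCoeff_X, mul_zero,
    add_zero, linCoeff_of_eq hg]
  rfl

theorem linMatrix_one [DecidableEq σ] :
    linMatrix (1 : MvPowerSeries σ k ≃ₐ[k] MvPowerSeries σ k) = 1 := by
  ext i j
  exact linCoeff_X i j

theorem linMatrix_pow [Fintype σ] [DecidableEq σ] (τ : MvPowerSeries σ k ≃ₐ[k] MvPowerSeries σ k)
    (n : ℕ) : linMatrix (τ ^ n) = linMatrix τ ^ n := by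
  induction n with
  | zero => rw [pow_zero, pow_zero, linMatrix_one]
  | succ n ih =>
    rw [pow_succ' τ, pow_succ, ← ih]
    ext i j
    rw [Matrix.mul_apply]
    exact linCoeff_algEquiv τ j _

theorem mem_sq_of_linCoeff_eq_zero [Finite σ] {f : MvPowerSeries σ k} (h0 : constantCoeff f = 0)
    (h1 : ∀ j, linCoeff j f = 0) :
    f ∈ Ideal.span (Set.range (X : σ → MvPowerSeries σ k)) ^ 2 := by
  cases nonempty_fintype σ
  obtain ⟨g, hg⟩ := exists_eq_C_add_sum f
  rw [hg, h0, map_zero, zero_add, sq]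
  exact Ideal.sum_mem _ fun i _ => Ideal.mul_mem_mul
    (mem_span_range_X_iff.2 (by rw [← linCoeff_of_eq hg, h1])) (Ideal.subset_span ⟨i, rfl⟩)

end LinearPart

section InverseFunction

variable {σ k : Type*} [Finite σ] [Field k]

/-- In other words, `θ` induces the identity on the associated graded ring. Products reduce to `N =
0` and `N = 1` by the Leibniz-type identity for `θ - id`. -/
theorem algHom_sub_self_mem_pow (θ : MvPowerSeries σ k →ₐ[k] MvPowerSeries σ k)
    (hθ : ∀ i, θ (X i) - X i ∈ Ideal.span (Set.range (X : σ → MvPowerSeries σ k)) ^ 2) (N : ℕ) :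
    ∀ f ∈ Ideal.span (Set.range (X : σ → MvPowerSeries σ k)) ^ N,
      θ f - f ∈ Ideal.span (Set.range (X : σ → MvPowerSeries σ k)) ^ (N + 1) := by
  cases nonempty_fintype σ
  set m := Ideal.span (Set.range (X : σ → MvPowerSeries σ k)) with hm
  have hXm : ∀ i, (X i : MvPowerSeries σ k) ∈ m := fun i => Ideal.subset_span ⟨i, rfl⟩
  have hsq : ∀ {x}, x ∈ m ^ 2 → x ∈ m := fun h => Ideal.pow_le_self two_ne_zero h
  have hC : ∀ c, θ (C c) = C c := fun c => θ.commutes _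
  have h0 : ∀ f, θ f - f ∈ m := by
    intro f
    obtain ⟨g, hg⟩ := exists_eq_C_add_sum f
    have hθX : ∀ i, θ (X i) ∈ m := fun i => by
      have := m.add_mem (hsq (hθ i)) (hXm i)
      rwa [sub_add_cancel] at this
    rw [hg, map_add, hC, map_sum, add_sub_add_left_eq_sub]
    refine m.sub_mem (Ideal.sum_mem _ fun i _ => ?_) (Ideal.sum_mem _ fun i _ => ?_)
    · rw [map_mul]
      exact m.mul_mem_left _ (hθX i)
    · exact m.mul_mem_left _ (hXm i)
  have h1 : ∀ f ∈ m, θ f - f ∈ m ^ 2 := by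
    intro f hf
    obtain ⟨g, hg⟩ := (Ideal.mem_span_range_iff_exists_fun).1 hf
    rw [← hg, map_sum, ← Finset.sum_sub_distrib]
    refine Ideal.sum_mem _ fun i _ => ?_
    have : θ (g i * X i) - g i * X i = θ (g i) * (θ (X i) - X i) + (θ (g i) - g i) * X i := by
      rw [map_mul]
      ring
    rw [this]
    refine Ideal.add_mem _ (Ideal.mul_mem_left _ _ (hθ i)) ?_
    rw [sq]
    exact Ideal.mul_mem_mul (h0 _) (hXm i)
  induction N with
  | zero => intro f _; simpa using h0 f
  | succ N ih =>
    intro f hf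
    rw [pow_succ] at hf
    induction hf using Submodule.mul_induction_on' with
    | mem_mul_mem a ha b hb =>
      have : θ (a * b) - a * b = (θ a - a) * θ b + a * (θ b - b) := by
        rw [map_mul]
        ring
      rw [this]
      have hθb : θ b ∈ m := by
        have := m.add_mem (hsq (h1 b hb)) hb
        rwa [sub_add_cancel] at this
      refine Ideal.add_mem _ ?_ ?_
      · rw [pow_succ]
        exact Ideal.mul_mem_mul (ih a ha) hθb
      · rw [show N + 1 + 1 = N + 2 from rfl, pow_add]
        exact Ideal.mul_mem_mul ha (h1 b hb)
    | add a _ b _ ha hb =>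
      have : θ (a + b) - (a + b) = (θ a - a) + (θ b - b) := by
        rw [map_add]
        ring
      rw [this]
      exact Ideal.add_mem _ ha hb

/-- An endomorphism of a power series ring with identity linear part is bijective. -/
theorem bijective_of_sub_mem_sq (θ : MvPowerSeries σ k →ₐ[k] MvPowerSeries σ k)
    (hθ : ∀ i, θ (X i) - X i ∈ Ideal.span (Set.range (X : σ → MvPowerSeries σ k)) ^ 2) :
    Function.Bijective θ := by
  have key := algHom_sub_self_mem_pow θ hθ
  set m := Ideal.span (Set.range (X : σ → MvPowerSeries σ k)) with hm
  have hpres : ∀ N, ∀ f ∈ m ^ N, θ f ∈ m ^ N := fun N f hf => by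
    have := (m ^ N).add_mem (Ideal.pow_le_pow_right (Nat.le_succ N) (key N f hf)) hf
    rwa [sub_add_cancel] at this
  have haus : ∀ f : MvPowerSeries σ k, (∀ N, f ∈ m ^ N) → f = 0 := fun f hf =>
    IsHausdorff.haus (I := m) inferInstance f fun n => by
      rw [SModEq.zero, smul_eq_mul, Ideal.mul_top]
      exact hf n
  constructor
  · rw [injective_iff_map_eq_zero]
    intro f hf
    refine haus f fun N => ?_
    induction N with
    | zero => simp
    | succ N ih =>
      have := key N f ih
      rwa [hf, zero_sub, neg_mem_iff] at this
  · intro r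
    -- Successive approximation of a preimage of `r`: since `θ - id` raises the order, each
    -- correction by the current error gains one power of `m`.
    let s : ℕ → MvPowerSeries σ k := fun N => Nat.rec 0 (fun _ t => t + (r - θ t)) N
    have hs : ∀ N, s (N + 1) = s N + (r - θ (s N)) := fun _ => rfl
    have hr : ∀ N, r - θ (s N) ∈ m ^ N := by
      intro N
      induction N with
      | zero => simp
      | succ N ih =>
        have := key N _ ih
        rw [← neg_mem_iff] at this
        convert this using 1
        rw [hs, map_add]
        ring
    have hcauchy : ∀ {a b : ℕ}, a ≤ b → s b - s a ∈ m ^ a := by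
      intro a b hab
      induction b, hab using Nat.le_induction with
      | base => simp
      | succ b hab ih =>
        have : s (b + 1) - s a = (s b - s a) + (r - θ (s b)) := by
          rw [hs]
          ring
        rw [this]
        exact Ideal.add_mem _ ih (Ideal.pow_le_pow_right hab (hr b))
    obtain ⟨L, hL⟩ := IsPrecomplete.prec (I := m) inferInstance (f := s) fun {a b} hab => by
      rw [SModEq.comm, SModEq.sub_mem, smul_eq_mul, Ideal.mul_top]
      exact hcauchy hab
    refine ⟨L, ?_⟩
    rw [← sub_eq_zero]
    refine haus _ fun N => ?_
    have h1 := hL N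
    rw [SModEq.sub_mem, smul_eq_mul, Ideal.mul_top] at h1
    have h2 := Ideal.add_mem _ (hr N) (hpres N _ h1)
    rw [← neg_mem_iff]
    convert h2 using 1
    rw [map_sub]
    ring

end InverseFunction

end MvPowerSeries

/-! ### Linearization and equivariant formal curves -/

namespace MvPowerSeries

section Linearization

variable {σ k : Type*} [Fintype σ] [DecidableEq σ] [Field k]

/-- An automorphism of finite order invertible in `k` is linear in suitable coordinates. -/
theorem exists_linearization (τ : MvPowerSeries σ k ≃ₐ[k] MvPowerSeries σ k) {n : ℕ}
    (hτ : τ ^ n = 1) (hn : (n : k) ≠ 0) :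
    ∃ θ : MvPowerSeries σ k ≃ₐ[k] MvPowerSeries σ k,
      ∀ i, τ (θ (X i)) = ∑ l, C (linMatrix τ i l) * θ (X l) := by
  set A := linMatrix τ with hA
  have hA1 : A ^ n = 1 := by rw [hA, ← linMatrix_pow, hτ, linMatrix_one]
  obtain ⟨n, rfl⟩ : ∃ n', n = n' + 1 := Nat.exists_eq_succ_of_ne_zero (by rintro rfl; simp at hn)
  set B := A ^ n with hB
  have hAB : A * B = 1 := by rw [hB, ← pow_succ', hA1]
  have hBA : B * A = 1 := by rw [hB, ← pow_succ, hA1]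
  have hB1 : B ^ (n + 1) = 1 := by rw [hB, ← pow_mul, mul_comm, pow_mul, hA1, one_pow]
  have hBAj : ∀ j, B ^ j * A ^ j = 1 := fun j => by
    rw [← (show Commute B A from hBA.trans hAB.symm).mul_pow, hBA, one_pow]
  -- The new coordinates `y` average A⁻ʲτʲ(x) over the cyclic group, with `B` = A⁻¹. Each term has
  -- linear part x, and `τ` carries the `j`-th term to `A` times the next.
  let F : ℕ → σ → MvPowerSeries σ k := fun j i => ∑ l, C ((B ^ j) i l) * (τ ^ j) (X l)
  let y : σ → MvPowerSeries σ k := fun i =>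
    C (((n + 1 : ℕ) : k)⁻¹) * ∑ j ∈ Finset.range (n + 1), F j i
  have hτC : ∀ c, τ (C c) = C c := fun c => τ.commutes c
  have hFτ : ∀ j i, τ (F j i) = ∑ l, C (A i l) * F (j + 1) l := by
    intro j i
    have hrec : B ^ j = A * B ^ (j + 1) := by rw [pow_succ', ← mul_assoc, hAB, one_mul]
    simp only [F, map_sum, map_mul, hτC, Finset.mul_sum]
    rw [Finset.sum_comm]
    refine Finset.sum_congr rfl fun l _ => ?_
    rw [hrec, Matrix.mul_apply, map_sum, Finset.sum_mul]
    refine Finset.sum_congr rfl fun m _ => ?_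
    rw [map_mul, mul_assoc, pow_succ' τ]
    rfl
  have hF0 : F (n + 1) = F 0 := by
    funext i
    simp only [F, hτ, hB1, pow_zero]
  have hFsum : ∀ i, ∑ j ∈ Finset.range (n + 1), F (j + 1) i =
      ∑ j ∈ Finset.range (n + 1), F j i := by
    intro i
    rw [Finset.sum_range_succ, hF0, Finset.sum_range_succ' (fun j => F j i)]
  have hyτ : ∀ i, τ (y i) = ∑ l, C (A i l) * y l := by
    intro i
    simp only [y, map_mul, hτC, map_sum, hFτ]
    rw [Finset.sum_comm, Finset.mul_sum]
    refine Finset.sum_congr rfl fun l _ => ?_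
    rw [← Finset.mul_sum, hFsum]
    ring
  have hy0 : ∀ i, constantCoeff (y i) = 0 := by
    intro i
    simp only [y, F, map_mul, map_sum, constantCoeff_algEquiv, constantCoeff_X, mul_zero,
      Finset.sum_const_zero]
  have hylin : ∀ i m, linCoeff m (y i) = (1 : Matrix σ σ k) i m := by
    intro i m
    have hF : ∀ j, linCoeff m (F j i) = (1 : Matrix σ σ k) i m := by
      intro j
      rw [← hBAj j, Matrix.mul_apply, map_sum]
      refine Finset.sum_congr rfl fun l _ => ?_
      rw [linCoeff_mul, linCoeff_C, zero_mul, add_zero, constantCoeff_C, hA, ← linMatrix_pow]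
      rfl
    simp only [y]
    rw [linCoeff_mul, linCoeff_C, zero_mul, add_zero, constantCoeff_C, map_sum,
      Finset.sum_congr rfl fun j _ => hF j, Finset.sum_const, Finset.card_range, nsmul_eq_mul,
      inv_mul_cancel_left₀ hn]
  have hs : HasSubst y := hasSubst_of_constantCoeff_zero hy0
  have hsX : ∀ i, substAlgHom (R := k) hs (X i) = y i := fun i => substAlgHom_X hs i
  have hbij : Function.Bijective (substAlgHom (R := k) hs) := by
    refine bijective_of_sub_mem_sq _ fun i => ?_
    rw [hsX]
    refine mem_sq_of_linCoeff_eq_zero ?_ fun j => ?_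
    · rw [map_sub, hy0, constantCoeff_X, sub_zero]
    · rw [map_sub, hylin, linCoeff_X, sub_self]
  refine ⟨AlgEquiv.ofBijective (substAlgHom hs) hbij, fun i => ?_⟩
  simp only [AlgEquiv.ofBijective_apply, hsX]
  exact hyτ i

/-- An automorphism of finite order invertible in `k` with trivial linear part is trivial. -/
theorem eq_one_of_linMatrix_eq_one (τ : MvPowerSeries σ k ≃ₐ[k] MvPowerSeries σ k) {n : ℕ}
    (hτ : τ ^ n = 1) (hn : (n : k) ≠ 0) (h1 : linMatrix τ = 1) : τ = 1 := by
  obtain ⟨θ, hθ⟩ := exists_linearization τ hτ hn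
  have hfix : ∀ i, τ (θ (X i)) = θ (X i) := by
    intro i
    rw [hθ, h1, Finset.sum_eq_single i]
    · simp
    · intro b _ hb
      rw [Matrix.one_apply_ne hb.symm, map_zero, zero_mul]
    · simp
  have : τ.toAlgHom.comp θ.toAlgHom = θ.toAlgHom :=
    algHom_ext_of_constantCoeff hfix fun i => by
      change constantCoeff (τ (θ (X i))) = 0
      rw [constantCoeff_algEquiv, constantCoeff_algEquiv, constantCoeff_X]
  ext1 f
  have h2 := DFunLike.congr_fun this (θ.symm f)
  simpa using h2

end Linearization

/-- A matrix of prime power order, invertible in the algebraically closed field `K`, has an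
eigenvalue of the same order. -/
theorem exists_primitive_eigenvector {σ K : Type*} [Fintype σ] [DecidableEq σ] [Field K]
    [IsAlgClosed K] {p r : ℕ} (hp : p.Prime) (hpK : (p : K) ≠ 0) (A : Matrix σ σ K)
    (h1 : A ^ p ^ (r + 1) = 1) (h2 : A ^ p ^ r ≠ 1) :
    ∃ (ζ : K) (c : σ → K), IsPrimitiveRoot ζ (p ^ (r + 1)) ∧ c ≠ 0 ∧ A.mulVec c = ζ • c := by
  let a : Module.End K (σ → K) := Matrix.toLin' A
  have hpow : ∀ n, a ^ n = Matrix.toLin' (A ^ n) := fun n => (Matrix.toLin'_pow A n).symm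
  have ha1 : a ^ p ^ (r + 1) = 1 := by rw [hpow, h1, Matrix.toLin'_one]; rfl
  have ha2 : a ^ p ^ r - 1 ≠ 0 := by
    rw [sub_ne_zero, hpow]
    intro h
    apply h2
    apply Matrix.toLin'.injective
    rw [h, Matrix.toLin'_one]
    rfl
  set b := a ^ p ^ r - 1 with hb
  have hcomm : Commute a b := (Commute.pow_right (Commute.refl a) _).sub_right (Commute.one_right a)
  -- Looking for the eigenvector in the range of `b` controls the order of `ζ` without diagonalizing
  -- `a`.
  let W := LinearMap.range b
  have hmaps : ∀ w ∈ W, a w ∈ W := by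
    rintro _ ⟨v, rfl⟩
    exact ⟨a v, by rw [← Module.End.mul_apply, ← hcomm.eq, Module.End.mul_apply]⟩
  have hWn : Nontrivial W := by
    rw [Submodule.nontrivial_iff_ne_bot]
    intro h
    exact ha2 (LinearMap.range_eq_bot.1 h)
  obtain ⟨ζ, hζ⟩ := Module.End.exists_eigenvalue (a.restrict hmaps)
  obtain ⟨w, hw, hw0⟩ := hζ.exists_hasEigenvector
  rw [Module.End.mem_eigenspace_iff] at hw
  have hac : a (w : σ → K) = ζ • (w : σ → K) := congrArg Subtype.val hw
  have hc0 : (w : σ → K) ≠ 0 := fun h => hw0 (Subtype.ext h)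
  have hacn : ∀ n : ℕ, (a ^ n) (w : σ → K) = ζ ^ n • (w : σ → K) := by
    intro n
    induction n with
    | zero => simp
    | succ n ih => rw [pow_succ, Module.End.mul_apply, hac, map_smul, ih, smul_smul, pow_succ']
  obtain ⟨v, hv⟩ := w.2
  refine ⟨ζ, w, ?_, hc0, hac⟩
  have hz1 : ζ ^ p ^ (r + 1) = 1 := by
    have := hacn (p ^ (r + 1))
    rw [ha1, Module.End.one_apply] at this
    exact (smul_left_injective K hc0 (by simpa using this)).symm
  have hz2 : ζ ^ p ^ r ≠ 1 := by
    intro h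
    have hbw : b (w : σ → K) = 0 := by
      rw [hb, LinearMap.sub_apply, hacn, h, one_smul, Module.End.one_apply, sub_self]
    -- If ζ^(p^r) = 1, then a^(p^r) fixes w = b v and translates v by w. Its p-th power is the
    -- identity, so p • w = 0, which is impossible.
    have hP : ∀ j : ℕ, ((a ^ p ^ r) ^ j) v = v + (j : K) • (w : σ → K) := by
      intro j
      induction j with
      | zero => simp
      | succ j ih =>
        have hav : (a ^ p ^ r) v = v + (w : σ → K) := by
          rw [← hv, hb, LinearMap.sub_apply, Module.End.one_apply]
          abel
        rw [pow_succ', Module.End.mul_apply, ih, map_add, map_smul, hav, hacn, h, one_smul,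
          Nat.cast_succ, add_smul, one_smul]
        abel
    have := hP p
    rw [← pow_mul, ← pow_succ, ha1, Module.End.one_apply] at this
    have h3 : (p : K) • (w : σ → K) = 0 := by simpa using this.symm
    rcases smul_eq_zero.1 h3 with h4 | h4
    · exact hpK h4
    · exact hc0 h4
  have : Fact p.Prime := ⟨hp⟩
  rw [IsPrimitiveRoot.iff_orderOf]
  exact orderOf_eq_prime_pow hz2 hz1

theorem rescale_C {K : Type*} [CommSemiring K] (a b : K) :
    PowerSeries.rescale a (PowerSeries.C b) = PowerSeries.C b := by
  ext n
  rw [PowerSeries.coeff_rescale, PowerSeries.coeff_C]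
  split_ifs with h <;> simp [h]

/-- An automorphism of prime power order invertible in `k` has an equivariant formal curve on
whose parameter it acts through a primitive root of unity. -/
theorem exists_equivariant_curve {σ k K : Type*} [Finite σ] [Field k] [Field K] [Algebra k K]
    [IsAlgClosed K] {p r : ℕ} (hp : p.Prime) (hpk : (p : k) ≠ 0)
    (τ : MvPowerSeries σ k ≃ₐ[k] MvPowerSeries σ k) (hτ : orderOf τ = p ^ (r + 1)) :
    ∃ (ζ : K) (φ : MvPowerSeries σ k →ₐ[k] PowerSeries K) (y : MvPowerSeries σ k) (c : K),
      IsPrimitiveRoot ζ (p ^ (r + 1)) ∧ c ≠ 0 ∧ φ y = PowerSeries.C c * PowerSeries.X ∧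
      (∀ f, φ (τ f) = PowerSeries.rescale ζ (φ f)) ∧
      ∀ f, constantCoeff f = 0 → PowerSeries.constantCoeff (φ f) = 0 := by
  classical
  cases nonempty_fintype σ
  have hpn : ∀ s : ℕ, ((p ^ s : ℕ) : k) ≠ 0 := fun s => by
    rw [Nat.cast_pow]
    exact pow_ne_zero _ hpk
  have hτ1 : τ ^ p ^ (r + 1) = 1 := by rw [← hτ, pow_orderOf_eq_one]
  have hτ2 : τ ^ p ^ r ≠ 1 := by
    intro h
    have := orderOf_dvd_of_pow_eq_one h
    rw [hτ, Nat.pow_dvd_pow_iff_le_right hp.one_lt] at this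
    omega
  obtain ⟨θ, hθ⟩ := exists_linearization τ hτ1 (hpn _)
  set A := linMatrix τ with hA
  have hA1 : A ^ p ^ (r + 1) = 1 := by rw [hA, ← linMatrix_pow, hτ1, linMatrix_one]
  -- The linear part keeps the exact order, as a nontrivial automorphism of order `p` has nontrivial
  -- linear part.
  have hA2 : A ^ p ^ r ≠ 1 := by
    intro h
    refine hτ2 (eq_one_of_linMatrix_eq_one (τ ^ p ^ r) (n := p) ?_ hpk ?_)
    · rw [← pow_mul, ← pow_succ, hτ1]
    · rw [linMatrix_pow, h]
  let ι := algebraMap k K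
  obtain ⟨ζ, c, hζ, hc, hAc⟩ := exists_primitive_eigenvector (K := K) (r := r) hp
    (by rw [← map_natCast ι]; exact (map_ne_zero ι).2 hpk) (A.map ι)
    (by rw [← Matrix.map_pow, hA1, Matrix.map_one _ (map_zero _) (map_one _)])
    (by
      intro h
      apply hA2
      rw [← Matrix.map_pow] at h
      apply Matrix.map_injective ι.injective
      change (A ^ p ^ r).map ι = (1 : Matrix σ σ k).map ι
      rw [h, Matrix.map_one _ (map_zero _) (map_one _)])
  obtain ⟨i₀, hi₀⟩ := Function.ne_iff.1 hc
  -- In linearizing coordinates the curve is the line through the eigenvector `c`, on which `A`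
  -- multiplies the parameter by `ζ`.
  let a : σ → MvPowerSeries Unit K := fun i => C (c i) * X ()
  have ha0 : ∀ i, constantCoeff (a i) = 0 := fun i => by simp [a]
  have ha : HasSubst a := hasSubst_of_constantCoeff_zero ha0
  let ev : MvPowerSeries σ k →ₐ[k] MvPowerSeries Unit K := substAlgHom ha
  have hev : ∀ i, ev (X i) = a i := fun i => substAlgHom_X ha i
  have hevC : ∀ x, ev (C x) = C (ι x) := fun x => by
    rw [← algebraMap_apply]
    exact ev.commutes x
  let φ : MvPowerSeries σ k →ₐ[k] MvPowerSeries Unit K := ev.comp θ.symm.toAlgHom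
  have hφ : ∀ f, φ f = ev (θ.symm f) := fun _ => rfl
  have hφθ : ∀ f, φ (θ f) = ev f := fun f => by rw [hφ, AlgEquiv.symm_apply_apply]
  let ρ : MvPowerSeries Unit K →ₐ[k] MvPowerSeries Unit K :=
    { (PowerSeries.rescale ζ : PowerSeries K →+* PowerSeries K) with
      commutes' := fun x => by
        rw [algebraMap_apply]
        exact rescale_C ζ (ι x) }
  have hρ : ∀ f, ρ f = PowerSeries.rescale ζ f := fun _ => rfl
  have hρa : ∀ i, ρ (a i) = C (ζ * c i) * X () := by
    intro i
    rw [hρ]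
    change PowerSeries.rescale ζ (PowerSeries.C (c i) * PowerSeries.X) =
      PowerSeries.C (ζ * c i) * PowerSeries.X
    rw [map_mul, rescale_C, PowerSeries.rescale_X, map_mul]
    ring
  refine ⟨ζ, φ, θ (X i₀), c i₀, hζ, hi₀, ?_, ?_, ?_⟩
  · rw [hφθ, hev]
    rfl
  · have hcomp : (φ.comp τ.toAlgHom).comp θ.toAlgHom = ρ.comp ev := by
      have hX : ∀ i, φ (τ (θ (X i))) = ρ (ev (X i)) := by
        intro i
        rw [hθ, map_sum, hev, hρa]
        have : ∀ l, φ (C (A i l) * θ (X l)) = C (ι (A i l) * c l) * X () := by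
          intro l
          rw [map_mul, hφθ, hev, map_mul, mul_assoc]
          congr 1
          rw [← algebraMap_apply]
          exact φ.commutes _
        simp_rw [this]
        rw [← Finset.sum_mul, ← map_sum]
        congr 2
        exact congrFun hAc i
      refine algHom_ext_of_constantCoeff hX fun i => ?_
      change constantCoeff (φ (τ (θ (X i)))) = 0
      rw [hX, hev, hρa, map_mul, constantCoeff_X, mul_zero]
    intro f
    have h := DFunLike.congr_fun hcomp (θ.symm f)
    change φ (τ (θ (θ.symm f))) = ρ (ev (θ.symm f)) at h
    rw [AlgEquiv.apply_symm_apply] at h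
    rw [h]
    rfl
  · intro f hf
    have hg : constantCoeff (θ.symm f) = 0 := by rw [constantCoeff_algEquiv, hf]
    obtain ⟨g, hg'⟩ := exists_eq_C_add_sum (θ.symm f)
    change constantCoeff (φ f) = 0
    rw [hφ, hg', hg, map_zero, zero_add, map_sum, map_sum]
    refine Finset.sum_eq_zero fun i _ => ?_
    rw [map_mul, map_mul, hev, ha0, mul_zero]

end MvPowerSeries

/-! ### Semi-invariants and their restriction to the curve -/

namespace MvPowerSeries

variable {σ k : Type*} [Field k]

/-- The twisted sum over the iterates of an automorphism is a semi-invariant. -/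
theorem algEquiv_twisted_sum {q : ℕ} {τ : MvPowerSeries σ k ≃ₐ[k] MvPowerSeries σ k}
    (hτ : τ ^ q = 1) {a : k} (ha : a ^ q = 1) (y : MvPowerSeries σ k) :
    τ (∑ j ∈ Finset.range q, (a⁻¹) ^ j • (τ ^ j) y) =
      a • ∑ j ∈ Finset.range q, (a⁻¹) ^ j • (τ ^ j) y := by
  cases q with
  | zero => simp
  | succ q =>
    have ha0 : a ≠ 0 := by
      rintro rfl
      simp at ha
    have hF : ∀ j, τ ((a⁻¹) ^ j • (τ ^ j) y) = a • ((a⁻¹) ^ (j + 1) • (τ ^ (j + 1)) y) := by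
      intro j
      rw [map_smul, smul_smul, pow_succ' a⁻¹, ← mul_assoc, mul_inv_cancel₀ ha0, one_mul,
        pow_succ' τ]
      rfl
    rw [map_sum, Finset.smul_sum]
    simp_rw [hF]
    rw [← Finset.smul_sum, ← Finset.smul_sum, Finset.sum_range_succ, hτ, inv_pow, ha, inv_one,
      Finset.sum_range_succ' (fun j => (a⁻¹) ^ j • (τ ^ j) y), pow_zero, pow_zero]

/-- Projection of a power of an eigenvector to an isotypic component, compared along an
equivariant curve. -/
theorem exists_semiinvariant {K : Type*} [Field K] [Algebra k K] {q : ℕ}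
    {τ : MvPowerSeries σ k ≃ₐ[k] MvPowerSeries σ k} (hτ : τ ^ q = 1) (hq : (q : k) ≠ 0)
    {ζ c : K} {φ : MvPowerSeries σ k →ₐ[k] PowerSeries K} {y : MvPowerSeries σ k}
    (hy : φ y = PowerSeries.C c * PowerSeries.X)
    (hφ : ∀ f, φ (τ f) = PowerSeries.rescale ζ (φ f)) {a : k} (ha : a ^ q = 1) {t : ℕ}
    (hat : algebraMap k K a = ζ ^ t) :
    ∃ u, τ u = a • u ∧ φ u = PowerSeries.C (c ^ t) * PowerSeries.X ^ t := by
  obtain ⟨q, rfl⟩ : ∃ q', q = q' + 1 := Nat.exists_eq_succ_of_ne_zero (by rintro rfl; simp at hq)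
  have ha0 : a ≠ 0 := by
    rintro rfl
    simp at ha
  let F : ℕ → MvPowerSeries σ k := fun j => (a⁻¹) ^ j • (τ ^ j) (y ^ t)
  have hF : ∀ j, τ (F j) = a • F (j + 1) := by
    intro j
    simp only [F]
    rw [map_smul, smul_smul, pow_succ' a⁻¹, ← mul_assoc, mul_inv_cancel₀ ha0, one_mul,
      pow_succ' τ]
    rfl
  -- On the curve `y ^ t` already has weight ζ^t, the image of `a`, so every term of the twisted
  -- average restricts to the same series.
  have hφF : ∀ j, φ (F j) = PowerSeries.C (c ^ t) * PowerSeries.X ^ t := by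
    intro j
    induction j with
    | zero =>
      simp only [F]
      rw [pow_zero, pow_zero, one_smul, AlgEquiv.one_apply, map_pow, hy, mul_pow, map_pow]
    | succ j ih =>
      have h := congrArg φ (hF j)
      rw [hφ, ih, map_smul, map_mul, rescale_C, map_pow (PowerSeries.rescale ζ),
        PowerSeries.rescale_X, mul_pow] at h
      have hsm : ∀ z : PowerSeries K, a • z = PowerSeries.C (ζ ^ t) * z := by
        intro z
        rw [← hat, ← algebraMap_smul K a z, PowerSeries.smul_eq_C_mul]
      have hne : PowerSeries.C (ζ ^ t) ≠ 0 := by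
        rw [← hat]
        simpa using ha0
      rw [hsm] at h
      apply mul_left_cancel₀ hne
      rw [← h, map_pow PowerSeries.C ζ]
      ring
  refine ⟨((q + 1 : ℕ) : k)⁻¹ • ∑ j ∈ Finset.range (q + 1), F j, ?_, ?_⟩
  · rw [map_smul, smul_comm, algEquiv_twisted_sum hτ ha]
  · rw [map_smul, map_sum, Finset.sum_congr rfl fun j _ => hφF j, Finset.sum_const,
      Finset.card_range, ← Nat.cast_smul_eq_nsmul k, smul_smul, inv_mul_cancel₀ hq, one_smul]

/-- For two characters of a cyclic group of prime power order acting on a power series ring, one of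
the two is such that the corresponding semi-invariants divide each other modulo the ideal generated
by the nonunit invariants. -/
theorem exists_semiinvariants_mul_notMem [Finite σ] {p r : ℕ} (hp : p.Prime) (hpk : (p : k) ≠ 0)
    (τ : MvPowerSeries σ k ≃ₐ[k] MvPowerSeries σ k) (hτ : orderOf τ = p ^ r) {a b : k}
    (ha : a ^ p ^ r = 1) (hb : b ^ p ^ r = 1) :
    (∃ u v, τ u = a • u ∧ τ v = (b / a) • v ∧
      u * v ∉ Ideal.span {s | τ s = s ∧ constantCoeff s = 0}) ∨
    ∃ u v, τ u = b • u ∧ τ v = (a / b) • v ∧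
      u * v ∉ Ideal.span {s | τ s = s ∧ constantCoeff s = 0} := by
  cases r with
  | zero =>
    rw [pow_zero, orderOf_eq_one_iff] at hτ
    rw [pow_zero, pow_one] at ha hb
    subst hτ ha hb
    refine Or.inl ⟨1, 1, by simp, by simp, fun h => ?_⟩
    have hle : Ideal.span {s : MvPowerSeries σ k |
        (1 : MvPowerSeries σ k ≃ₐ[k] MvPowerSeries σ k) s = s ∧ constantCoeff s = 0} ≤
        RingHom.ker (constantCoeff (σ := σ) (R := k)) :=
      Ideal.span_le.2 fun s hs => hs.2
    have := hle h
    simp at this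
  | succ r =>
    obtain ⟨ζ, φ, y, c, hζ, hc, hy, hφ, hφ0⟩ :=
      exists_equivariant_curve (K := AlgebraicClosure k) hp hpk τ hτ
    set q := p ^ (r + 1) with hq
    have hq0 : (q : k) ≠ 0 := by
      rw [hq, Nat.cast_pow]
      exact pow_ne_zero _ hpk
    have hτ1 : τ ^ q = 1 := by rw [← hτ, pow_orderOf_eq_one]
    -- The restriction of an invariant is unchanged by rescaling with `ζ`, so only exponents
    -- divisible by `q` occur.
    have hspan : Ideal.span {s | τ s = s ∧ constantCoeff s = 0} ≤
        (Ideal.span {(PowerSeries.X : PowerSeries (AlgebraicClosure k)) ^ q}).comap φ := by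
      rw [Ideal.span_le]
      rintro s ⟨hs, hs0⟩
      change φ s ∈ Ideal.span {(PowerSeries.X : PowerSeries (AlgebraicClosure k)) ^ q}
      rw [Ideal.mem_span_singleton, PowerSeries.X_pow_dvd_iff]
      intro j hj
      rcases Nat.eq_zero_or_pos j with rfl | hj0
      · rw [PowerSeries.coeff_zero_eq_constantCoeff_apply]
        exact hφ0 s hs0
      · have h := congrArg (PowerSeries.coeff j) (hφ s)
        rw [hs, PowerSeries.coeff_rescale] at h
        have hζj : ζ ^ j ≠ 1 := hζ.pow_ne_one_of_pos_of_lt hj0.ne' hj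
        by_contra hne
        exact hζj (mul_right_cancel₀ hne (by rw [one_mul, ← h]))
    -- The smaller exponent belongs to `u`, so that `v` can have exponent `t' - t`. The product then
    -- has order `t' < q` on the curve, outside the ideal of `hspan`.
    have key : ∀ {a b : k} {t t' : ℕ}, a ^ q = 1 → b ^ q = 1 →
        algebraMap k (AlgebraicClosure k) a = ζ ^ t →
        algebraMap k (AlgebraicClosure k) b = ζ ^ t' → t ≤ t' → t' < q →
        ∃ u v, τ u = a • u ∧ τ v = (b / a) • v ∧
          u * v ∉ Ideal.span {s | τ s = s ∧ constantCoeff s = 0} := by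
      intro a b t t' ha hb hat hbt htt htq
      have hζ0 : ζ ≠ 0 := hζ.ne_zero (by rintro h; simp [h] at hq0)
      have hba : algebraMap k (AlgebraicClosure k) (b / a) = ζ ^ (t' - t) := by
        rw [map_div₀, hat, hbt, pow_sub₀ _ hζ0 htt, div_eq_mul_inv]
      obtain ⟨u, hu, hu'⟩ := exists_semiinvariant hτ1 hq0 hy hφ ha hat
      obtain ⟨v, hv, hv'⟩ := exists_semiinvariant hτ1 hq0 hy hφ
        (by rw [div_pow, ha, hb, div_one]) hba
      refine ⟨u, v, hu, hv, fun h => ?_⟩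
      have h1 := hspan h
      rw [Ideal.mem_comap, Ideal.mem_span_singleton, PowerSeries.X_pow_dvd_iff] at h1
      have h2 := h1 t' htq
      have h3 : φ (u * v) = PowerSeries.C (c ^ t') * PowerSeries.X ^ t' := by
        obtain ⟨s, rfl⟩ := Nat.exists_eq_add_of_le htt
        rw [map_mul, hu', hv', Nat.add_sub_cancel_left, pow_add, pow_add, map_mul]
        ring
      rw [h3, PowerSeries.coeff_C_mul, PowerSeries.coeff_X_pow_self, mul_one] at h2
      exact pow_ne_zero _ hc h2
    have hqne : NeZero q := ⟨by rintro h; simp [h] at hq0⟩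
    obtain ⟨t, htq, ht⟩ := hζ.eq_pow_of_pow_eq_one
      (show algebraMap k (AlgebraicClosure k) a ^ q = 1 by rw [← map_pow, ha, map_one])
    obtain ⟨t', htq', ht'⟩ := hζ.eq_pow_of_pow_eq_one
      (show algebraMap k (AlgebraicClosure k) b ^ q = 1 by rw [← map_pow, hb, map_one])
    rcases le_total t t' with h | h
    · exact Or.inl (key ha hb ht.symm ht'.symm h htq')
    · exact Or.inr (key hb ha ht'.symm ht.symm h htq)

/-! ### The invariant ring is local and noetherian -/

section Invariants

variable {τ : MvPowerSeries σ k ≃ₐ[k] MvPowerSeries σ k} {S : Subalgebra k (MvPowerSeries σ k)}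

/-- A quotient of invariants is invariant, by cancellation. Through this property alone divisibility
in `S` is tested in the factorial ring. -/
theorem dvd_of_dvd_invariants (hS : ∀ x, x ∈ S ↔ τ x = x) {a b : S}
    (h : (a : MvPowerSeries σ k) ∣ b) : a ∣ b := by
  by_cases ha : (a : MvPowerSeries σ k) = 0
  · rw [ha, zero_dvd_iff] at h
    rw [show b = 0 from Subtype.ext h]
    exact dvd_zero a
  · obtain ⟨c, hc⟩ := h
    refine ⟨⟨c, (hS c).2 ?_⟩, Subtype.ext hc⟩
    have h1 := congrArg τ hc
    rw [map_mul, (hS _).1 a.2, (hS _).1 b.2, hc] at h1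
    exact (mul_left_cancel₀ ha h1).symm

theorem isLocalRing_invariants (hS : ∀ x, x ∈ S ↔ τ x = x) : IsLocalRing S := by
  have : IsLocalHom (algebraMap S (MvPowerSeries σ k)) := ⟨fun a ha => by
    have h1 : (a : MvPowerSeries σ k) ∣ (1 : S) := ha.dvd
    exact isUnit_of_dvd_one (dvd_of_dvd_invariants hS h1)⟩
  exact RingHom.domain_isLocalRing (algebraMap S (MvPowerSeries σ k))

theorem isUnit_invariants_of_constantCoeff_ne_zero (hS : ∀ x, x ∈ S ↔ τ x = x) {a : S}
    (ha : constantCoeff (a : MvPowerSeries σ k) ≠ 0) : IsUnit a := by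
  have h1 : (a : MvPowerSeries σ k) ∣ (1 : S) :=
    (isUnit_iff_constantCoeff.2 (isUnit_iff_ne_zero.2 ha)).dvd
  exact isUnit_of_dvd_one (dvd_of_dvd_invariants hS h1)

/-- The Reynolds operator of a finite cyclic group whose order is invertible. -/
theorem exists_reynolds (hS : ∀ x, x ∈ S ↔ τ x = x) {q : ℕ} (hτ : τ ^ q = 1)
    (hq : (q : k) ≠ 0) : ∃ e : MvPowerSeries σ k →ₗ[S] S, ∀ s : S, e s = s := by
  obtain ⟨q, rfl⟩ : ∃ q', q = q' + 1 := Nat.exists_eq_succ_of_ne_zero (by rintro rfl; simp at hq)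
  have hpow : ∀ (s : S) (j : ℕ), (τ ^ j) (s : MvPowerSeries σ k) = s := by
    intro s j
    induction j with
    | zero => simp
    | succ j ih => rw [pow_succ', AlgEquiv.mul_apply, ih, (hS _).1 s.2]
  let E : MvPowerSeries σ k → MvPowerSeries σ k := fun f =>
    ((q + 1 : ℕ) : k)⁻¹ • ∑ j ∈ Finset.range (q + 1), (τ ^ j) f
  have hE : ∀ f, E f ∈ S := by
    intro f
    rw [hS]
    simp only [E]
    rw [map_smul, map_sum]
    congr 1
    have : ∀ j, τ ((τ ^ j) f) = (τ ^ (j + 1)) f := fun j => by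
      rw [pow_succ', AlgEquiv.mul_apply]
    simp_rw [this]
    rw [Finset.sum_range_succ, hτ, Finset.sum_range_succ' (fun j => (τ ^ j) f), pow_zero]
  refine ⟨⟨⟨fun f => ⟨E f, hE f⟩, fun f g => Subtype.ext ?_⟩, fun s f => Subtype.ext ?_⟩,
    fun s => Subtype.ext ?_⟩
  · change E (f + g) = E f + E g
    simp only [E, map_add, Finset.sum_add_distrib, smul_add]
  · change E (s * f) = s * E f
    simp only [E, map_mul, hpow]
    rw [← Finset.mul_sum, mul_smul_comm]
  · change E s = s
    simp only [E, hpow]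
    rw [Finset.sum_const, Finset.card_range, ← Nat.cast_smul_eq_nsmul k, smul_smul,
      inv_mul_cancel₀ hq, one_smul]

/-- The Reynolds operator shows that extending an ideal and contracting it back returns it, so
ascending chains can be tested in the power series ring. -/
theorem isNoetherianRing_invariants [Finite σ] (hS : ∀ x, x ∈ S ↔ τ x = x) {q : ℕ}
    (hτ : τ ^ q = 1) (hq : (q : k) ≠ 0) : IsNoetherianRing S := by
  obtain ⟨e, he⟩ := exists_reynolds hS hτ hq
  have hmap : ∀ I : Ideal S, (I.map (algebraMap S (MvPowerSeries σ k))).comap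
      (algebraMap S (MvPowerSeries σ k)) = I := by
    intro I
    refine le_antisymm (fun s hs => ?_) Ideal.le_comap_map
    have : ∀ f ∈ I.map (algebraMap S (MvPowerSeries σ k)), ∀ r, e (r * f) ∈ I := by
      intro f hf
      refine Submodule.span_induction (p := fun f _ => ∀ r, e (r * f) ∈ I) ?_ ?_ ?_ ?_ hf
      · rintro _ ⟨s, hs, rfl⟩ r
        rw [mul_comm, ← Algebra.smul_def, map_smul]
        exact I.mul_mem_right _ hs
      · intro r
        rw [mul_zero, map_zero]
        exact I.zero_mem
      · intro x y _ _ hx hy r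
        rw [mul_add, map_add]
        exact I.add_mem (hx r) (hy r)
      · intro a x _ hx r
        rw [smul_eq_mul, ← mul_assoc]
        exact hx _
    have h := this _ hs 1
    rwa [one_mul, show e (algebraMap S (MvPowerSeries σ k) s) = s from he s] at h
  have hmono : Monotone fun I : Ideal S => I.map (algebraMap S (MvPowerSeries σ k)) :=
    fun I J h => Ideal.map_mono h
  have hinj : Function.Injective fun I : Ideal S => I.map (algebraMap S (MvPowerSeries σ k)) :=
    fun I J h => by
      rw [← hmap I, ← hmap J]
      exact congrArg _ h
  rw [isNoetherianRing_iff, isNoetherian_iff']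
  exact (hmono.strictMono_of_injective hinj).wellFoundedGT

end Invariants

end MvPowerSeries

/-! ### Semidualizing modules over a domain are ideals -/

section Ext

universe w

open Abelian in
/-- If `Ext¹(X, A)` vanishes, linear maps from `X` lift along surjections with kernel `A`. -/
theorem exists_lift_of_subsingleton_ext {R X A B C : Type w} [CommRing R]
    [AddCommGroup X] [Module R X] [AddCommGroup A] [Module R A] [AddCommGroup B] [Module R B]
    [AddCommGroup C] [Module R C]
    (hX : Subsingleton (Ext (ModuleCat.of R X) (ModuleCat.of R A) 1))
    (i : A →ₗ[R] B) (π : B →ₗ[R] C) (hi : Function.Injective i) (hπ : Function.Surjective π)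
    (hex : Function.Exact i π) (h : X →ₗ[R] C) : ∃ g : X →ₗ[R] B, π ∘ₗ g = h := by
  let T : ShortComplex (ModuleCat R) := ShortComplex.mk (ModuleCat.ofHom i) (ModuleCat.ofHom π)
    (by
      ext x
      exact hex.apply_apply_eq_zero x)
  have hT : T.ShortExact :=
    { exact := (ShortComplex.ShortExact.moduleCat_exact_iff_function_exact T).2 hex
      mono_f := (ModuleCat.mono_iff_injective _).2 hi
      epi_g := (ModuleCat.epi_iff_surjective _).2 hπ }
  obtain ⟨x, hx⟩ := Ext.covariant_sequence_exact₃ (ModuleCat.of R X) hT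
    (Ext.mk₀ (ModuleCat.ofHom h)) (zero_add 1) (hX.elim _ _)
  obtain ⟨g, rfl⟩ := (Ext.mk₀_bijective _ _).2 x
  rw [Ext.mk₀_comp_mk₀] at hx
  have hg := (Ext.mk₀_bijective _ _).1 hx
  refine ⟨g.hom, ?_⟩
  have := congrArg ModuleCat.Hom.hom hg
  exact this

end Ext

section Semidualizing

variable {S D : Type*} [CommRing S] [AddCommGroup D] [Module S D]

/-- A finitely generated faithful module has nonzero maps to every nonzero finitely generated
module. -/
theorem subsingleton_of_subsingleton_linearMap [IsNoetherianRing S] [Module.Finite S D]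
    (hD : ∀ a : S, (∀ x : D, a • x = 0) → a = 0) (T : Type*) [AddCommGroup T] [Module S T]
    [Module.Finite S T] (h : Subsingleton (D →ₗ[S] T)) : Subsingleton T := by
  -- Vanishing of Hom gives an annihilator of `D` that is regular on `T`; by faithfulness it is 0,
  -- and 0 is regular only on the zero module.
  obtain ⟨r, hr, hreg⟩ := IsSMulRegular.subsingleton_linearMap_iff.1 h
  have hr0 : r = 0 := hD r fun x => Module.mem_annihilator.1 hr x
  subst hr0
  exact ⟨fun a b => hreg (by simp)⟩

/-- A finitely generated module whose endomorphisms are the homotheties by elements of the domain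
`S` is isomorphic to an ideal of `S`. -/
theorem exists_injective_of_homothety_bijective [IsNoetherianRing S] [IsDomain S]
    [Module.Finite S D]
    (hD : Function.Bijective (LinearMap.lsmul S D : S →ₗ[S] D →ₗ[S] D)) :
    ∃ f : D →ₗ[S] S, Function.Injective f ∧ f ≠ 0 := by
  have hfaith : ∀ a : S, (∀ x : D, a • x = 0) → a = 0 := fun a ha =>
    (injective_iff_map_eq_zero _).1 hD.1 a (LinearMap.ext ha)
  have htf : ∀ (s : S) (x : D), s ≠ 0 → s • x = 0 → x = 0 := by
    let T := Submodule.torsion S D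
    have hTfin : Module.Finite S T := inferInstance
    obtain ⟨s, hsT, hs0⟩ : ∃ s : S, (∀ x : T, s • x = 0) ∧ s ≠ 0 := by
      obtain ⟨s, hs⟩ := Submodule.annihilator_top_inter_nonZeroDivisors
        (Submodule.torsion_isTorsion (R := S) (M := D))
      refine ⟨s, fun x => ?_, nonZeroDivisors.ne_zero hs.2⟩
      exact Submodule.mem_annihilator.1 hs.1 x Submodule.mem_top
    -- A map into the torsion submodule is a homothety by some `a` with `s * a = 0`, hence zero.
    have hsub : Subsingleton (D →ₗ[S] T) := by
      refine ⟨fun φ ψ => ?_⟩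
      suffices hall : ∀ φ : D →ₗ[S] T, φ = 0 by rw [hall φ, hall ψ]
      intro φ
      obtain ⟨a, ha⟩ := hD.2 (T.subtype ∘ₗ φ)
      have hax : ∀ x, a • x = (φ x : D) := fun x => LinearMap.congr_fun ha x
      have hsa : s * a = 0 := hfaith _ fun x => by
        rw [mul_smul, hax, ← Submodule.coe_smul, hsT, Submodule.coe_zero]
      have ha0 : a = 0 := (mul_eq_zero.1 hsa).resolve_left hs0
      ext x
      rw [← hax, ha0, zero_smul]
      rfl
    have hT := subsingleton_of_subsingleton_linearMap hfaith T hsub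
    intro r x hr hx
    have hxT : x ∈ T := (Submodule.mem_torsion_iff x).2 ⟨⟨r, mem_nonZeroDivisors_of_ne_zero hr⟩, hx⟩
    exact congrArg Subtype.val (hT.elim ⟨x, hxT⟩ 0)
  have hne : ¬ Subsingleton (D →ₗ[S] S) := fun h => by
    have := subsingleton_of_subsingleton_linearMap hfaith S h
    exact not_subsingleton S this
  obtain ⟨f, hf⟩ : ∃ f : D →ₗ[S] S, f ≠ 0 := by
    by_contra! hall
    exact hne ⟨fun φ ψ => by rw [hall φ, hall ψ]⟩
  refine ⟨f, ?_, hf⟩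
  rw [injective_iff_map_eq_zero]
  intro d hd
  by_contra hd0
  -- The endomorphism x ↦ f(x)d is a homothety that kills `d`, hence zero, although neither `f` nor
  -- `d` is.
  obtain ⟨a, ha⟩ := hD.2 (f.smulRight d)
  have hax : ∀ x, a • x = f x • d := fun x => LinearMap.congr_fun ha x
  have ha0 : a = 0 := by
    by_contra ha0
    exact hd0 (htf a d ha0 (by rw [hax, hd, zero_smul]))
  apply hf
  ext x
  by_contra hx
  exact hd0 (htf (f x) d hx (by rw [← hax, ha0, zero_smul]))

end Semidualizing

/-! ### Torsion-free tensor products of ideals in a local domain -/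

section Local

variable {S : Type*} [CommRing S] [IsLocalRing S]

/-- A submodule containing `𝔪 • N` is cut out by functionals with values in the residue field. -/
theorem exists_linearMap_residueField {N : Type*} [AddCommGroup N] [Module S N]
    (P : Submodule S N) (hP : IsLocalRing.maximalIdeal S • (⊤ : Submodule S N) ≤ P) {y : N}
    (hy : y ∉ P) :
    ∃ ℓ : N →ₗ[S] (S ⧸ IsLocalRing.maximalIdeal S), ℓ y ≠ 0 ∧ ∀ x ∈ P, ℓ x = 0 := by
  let _ : Field (S ⧸ IsLocalRing.maximalIdeal S) := Ideal.Quotient.field _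
  have htor : Module.IsTorsionBySet S (N ⧸ P) (IsLocalRing.maximalIdeal S) := by
    intro x s
    obtain ⟨x, rfl⟩ := P.mkQ_surjective x
    rw [← map_smul, Submodule.mkQ_apply, Submodule.Quotient.mk_eq_zero]
    exact hP (Submodule.smul_mem_smul s.2 trivial)
  let _ := htor.module
  have hy' : P.mkQ y ≠ 0 := by simpa using hy
  obtain ⟨f, hf⟩ : ∃ f : Module.Dual (S ⧸ IsLocalRing.maximalIdeal S) (N ⧸ P), f (P.mkQ y) ≠ 0 := by
    by_contra! h
    exact hy' ((Module.forall_dual_apply_eq_zero_iff (S ⧸ IsLocalRing.maximalIdeal S) _).1 h)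
  have : IsScalarTower S (S ⧸ IsLocalRing.maximalIdeal S) (N ⧸ P) := htor.isScalarTower
  refine ⟨(f.restrictScalars S) ∘ₗ P.mkQ, hf, fun x hx => ?_⟩
  have : P.mkQ x = 0 := by simpa using hx
  rw [LinearMap.comp_apply, this, map_zero]

/-- If `I ⊗ J` is torsion-free, `X ∈ I`, `W ∈ J` is a minimal generator, and `W / X` maps `I` to
`J`, then `I` is generated by `X`. -/
theorem eq_span_of_isTorsionFree_tensor [IsDomain S] [IsNoetherianRing S] (I J : Ideal S)
    (htf : Module.IsTorsionFree S (I ⊗[S] J)) (X : I) (W : J)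
    (hW : (W : S) ∉ IsLocalRing.maximalIdeal S * J)
    (h : ∀ Y : I, ∃ Z : J, (X : S) * Z = Y * W) : I = Ideal.span {(X : S)} := by
  set m := IsLocalRing.maximalIdeal S
  have hW0 : (W : S) ≠ 0 := fun h0 => hW (by rw [h0]; exact Ideal.zero_mem _)
  let P : Submodule S I := Submodule.span S {X} ⊔ m • ⊤
  let Q : Submodule S J := m • ⊤
  have hWQ : W ∉ Q := by
    intro hmem
    apply hW
    have : (J.subtype W) ∈ (m • (⊤ : Submodule S J)).map J.subtype := ⟨W, hmem, rfl⟩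
    rw [Submodule.map_smul'', Submodule.map_top, Submodule.range_subtype] at this
    exact this
  have hPtop : P = ⊤ := by
    rw [eq_top_iff]
    intro Y _
    by_contra hY
    obtain ⟨Z, hZ⟩ := h Y
    obtain ⟨ℓ, hℓY, hℓP⟩ := exists_linearMap_residueField P le_sup_right hY
    obtain ⟨ℓ', hℓW, -⟩ := exists_linearMap_residueField Q le_rfl hWQ
    have hY0 : (Y : S) ≠ 0 := fun h0 =>
      hY (by rw [show Y = 0 from Subtype.ext h0]; exact P.zero_mem)
    have hYX : (Y : S) • X = (X : S) • Y := Subtype.ext (mul_comm _ _)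
    have hWZ : (W : S) • Z = (Z : S) • W := Subtype.ext (mul_comm _ _)
    -- Multiplied by YW, both sides agree because XZ = YW; torsion-freeness allows the factor to be
    -- cancelled.
    have hrel : X ⊗ₜ[S] Z = Y ⊗ₜ[S] W := by
      have hreg : IsSMulRegular (I ⊗[S] J) ((Y : S) * W) :=
        htf.isSMulRegular (isRegular_iff_ne_zero.2 (mul_ne_zero hY0 hW0))
      apply hreg
      change ((Y : S) * W) • (X ⊗ₜ[S] Z) = ((Y : S) * W) • (Y ⊗ₜ[S] W)
      rw [← TensorProduct.smul_tmul_smul, hYX, hWZ, TensorProduct.smul_tmul_smul, hZ]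
    -- In the residue field the left side vanishes, since `ℓ` kills `X`, while the right side is a
    -- product of nonzero elements.
    have hκ : ℓ X * ℓ' Z = ℓ Y * ℓ' W := by
      have := congrArg (LinearMap.mul' S (S ⧸ m) ∘ₗ TensorProduct.map ℓ ℓ') hrel
      simpa using this
    rw [hℓP X (Submodule.mem_sup_left (Submodule.mem_span_singleton_self X)), zero_mul] at hκ
    exact mul_ne_zero hℓY hℓW hκ.symm
  have hnak : (⊤ : Submodule S I) ≤ Submodule.span S {X} :=
    Submodule.le_of_le_smul_of_le_jacobson_bot (I := m) (IsNoetherian.noetherian _)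
      (IsLocalRing.maximalIdeal_le_jacobson _) hPtop.ge
  refine le_antisymm (fun y hy => ?_) ?_
  · obtain ⟨s, hs⟩ := Submodule.mem_span_singleton.1 (hnak (show (⟨y, hy⟩ : I) ∈ ⊤ from trivial))
    exact Ideal.mem_span_singleton'.2 ⟨s, congrArg Subtype.val hs⟩
  · rw [Ideal.span_singleton_le_iff_mem]
    exact X.2

end Local

/-! ### Divisorial ideals and common divisors in a factorial extension -/

section Divisorial

/-- An ideal of a domain is divisorial if it is an intersection of fractional principal ideals. -/
def IsDivisorial {S : Type*} [CommRing S] (I : Ideal S) : Prop :=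
  ∀ e : S, (∀ a b : S, a ≠ 0 → (∀ i ∈ I, a ∣ b * i) → a ∣ b * e) → e ∈ I

/-- An ideal of `S` which is cut out by its common divisors in the extension `R`. -/
def IsDivisorialIn {S : Type*} (R : Type*) [CommRing S] [CommRing R] [Algebra S R] (I : Ideal S) :
    Prop :=
  ∀ e : S, (∀ f : R, (∀ i ∈ I, f ∣ algebraMap S R i) → f ∣ algebraMap S R e) → e ∈ I

variable {S R : Type*} [CommRing S] [CommRing R] [Algebra S R]

/-- Take the gcd of finitely many generators. The multiplier `c` lets fractions be tested as well.
-/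
theorem exists_gcd_ideal [IsNoetherianRing S] [IsDomain R] [UniqueFactorizationMonoid R]
    (I : Ideal S) : ∃ g : R, (∀ i ∈ I, g ∣ algebraMap S R i) ∧
      ∀ f c : R, (∀ i ∈ I, f ∣ c * algebraMap S R i) → f ∣ c * g := by
  classical
  let _ : StrongNormalizationMonoid R := UniqueFactorizationMonoid.strongNormalizationMonoid
  let _ : NormalizedGCDMonoid R := UniqueFactorizationMonoid.toNormalizedGCDMonoid R
  obtain ⟨s, hs⟩ := (isNoetherianRing_iff_ideal_fg S).1 inferInstance I
  refine ⟨s.gcd (algebraMap S R), fun i hi => ?_, fun f c h => ?_⟩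
  · rw [← hs] at hi
    refine Submodule.span_induction (p := fun i _ => s.gcd (algebraMap S R) ∣ algebraMap S R i)
      (fun x hx => Finset.gcd_dvd hx) ?_ ?_ ?_ hi
    · rw [map_zero]
      exact dvd_zero _
    · intro x y _ _ hx hy
      rw [map_add]
      exact dvd_add hx hy
    · intro a x _ hx
      rw [smul_eq_mul, map_mul]
      exact hx.mul_left _
  · refine ((Finset.gcd_mul_left' s (algebraMap S R) c).dvd_iff_dvd_right).1 ?_
    refine Finset.dvd_gcd fun x hx => h x ?_
    rw [← hs]
    exact Submodule.subset_span hx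

theorem algebraMap_injective_of_dvd
    (hdvd : ∀ a b : S, algebraMap S R a ∣ algebraMap S R b → a ∣ b) :
    Function.Injective (algebraMap S R) :=
  (injective_iff_map_eq_zero _).2 fun a ha => zero_dvd_iff.1 (hdvd 0 a (by rw [ha, map_zero]))

theorem IsDivisorial.isDivisorialIn [IsNoetherianRing S] [IsDomain R] [UniqueFactorizationMonoid R]
    (hdvd : ∀ a b : S, algebraMap S R a ∣ algebraMap S R b → a ∣ b) {I : Ideal S}
    (hI : IsDivisorial I) : IsDivisorialIn R I := by
  intro e he
  obtain ⟨g, hg, hg'⟩ := exists_gcd_ideal (R := R) I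
  refine hI e fun a b _ hab => hdvd _ _ ?_
  rw [map_mul]
  refine (hg' _ (algebraMap S R b) fun i hi => ?_).trans (mul_dvd_mul_left _ (he g hg))
  rw [← map_mul]
  exact map_dvd (algebraMap S R) (hab i hi)

/-- A reflexive module of rank one over a domain is isomorphic to a nonzero divisorial ideal. -/
theorem exists_isDivisorial_of_isReflexive [IsDomain S] (M : Type*) [AddCommGroup M] [Module S M]
    [Module.IsReflexive S M] (hM : Module.rank S M = 1) :
    ∃ I : Ideal S, I ≠ ⊥ ∧ IsDivisorial I ∧ Nonempty (M ≃ₗ[S] I) := by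
  have heval := Module.bijective_dual_eval S M
  have htf : ∀ (s : S) (m : M), s ≠ 0 → s • m = 0 → m = 0 := by
    intro s m hs hm
    apply heval.1
    rw [map_zero]
    ext f
    have h : s * f m = 0 := by rw [← smul_eq_mul, ← map_smul, hm, map_zero]
    exact (mul_eq_zero.1 h).resolve_left hs
  obtain ⟨f, m₀, hm₀⟩ : ∃ (f : Module.Dual S M) (m : M), f m ≠ 0 := by
    by_contra! h
    have hsub : Subsingleton M := ⟨fun a b => heval.1 (by
      ext f
      simp only [Module.Dual.eval_apply, h])⟩
    rw [rank_subsingleton'] at hM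
    exact zero_ne_one hM
  have hinj : Function.Injective f := by
    rw [injective_iff_map_eq_zero]
    intro m hm
    have hdep : ¬ LinearIndependent S ![m, m₀] := fun hli => by
      have := hli.cardinal_lift_le_rank
      rw [hM] at this
      simp at this
    rw [LinearIndependent.pair_iff] at hdep
    push Not at hdep
    obtain ⟨s, t, hst, hne⟩ := hdep
    have h := congrArg f hst
    rw [map_add, map_smul, map_smul, hm, smul_zero, zero_add, map_zero, smul_eq_mul] at h
    have ht : t = 0 := (mul_eq_zero.1 h).resolve_right hm₀
    rw [ht, zero_smul, add_zero] at hst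
    exact htf s m (fun hs => hne hs ht) hst
  have hrel : ∀ (φ : Module.Dual S M) (m : M), φ m₀ * f m = f m₀ * φ m := by
    intro φ m
    have : f m₀ • m = f m • m₀ := hinj (by simp [mul_comm])
    have h := congrArg φ this
    rw [map_smul, map_smul, smul_eq_mul, smul_eq_mul] at h
    rw [h, mul_comm]
  refine ⟨LinearMap.range f, ?_, ?_, ⟨LinearEquiv.ofInjective f hinj⟩⟩
  · intro h
    rw [LinearMap.range_eq_bot] at h
    exact hm₀ (by rw [h]; rfl)
  · intro e he
    have hex : ∀ φ : Module.Dual S M, f m₀ ∣ φ m₀ * e := fun φ => by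
      refine he _ _ hm₀ ?_
      rintro _ ⟨m, rfl⟩
      exact ⟨_, hrel φ m⟩
    choose c hc using hex
    -- Functionals on `M` are proportional, so φ ↦ φ(m₀)e / f(m₀) is the only candidate for
    -- evaluation at a preimage of `e`. Reflexivity supplies that preimage.
    let ψ : Module.Dual S (Module.Dual S M) :=
      { toFun := c
        map_add' := fun φ χ => mul_left_cancel₀ hm₀ (by
          rw [← hc, mul_add, ← hc, ← hc, LinearMap.add_apply, add_mul])
        map_smul' := fun s φ => mul_left_cancel₀ hm₀ (by
          rw [← hc, RingHom.id_apply, smul_eq_mul, mul_left_comm, ← hc, LinearMap.smul_apply,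
            smul_eq_mul, mul_assoc]) }
    obtain ⟨m, hm⟩ := heval.2 ψ
    refine ⟨m, ?_⟩
    have h1 : f m = c f := LinearMap.congr_fun hm f
    rw [h1]
    exact mul_left_cancel₀ hm₀ (hc f).symm

/-- A semidualizing module over `S` is isomorphic to an ideal cut out by its common divisors in a
factorial extension `R`. -/
theorem exists_isDivisorialIn_of_ext {S : Type u} {R : Type*} [CommRing S] [CommRing R]
    [Algebra S R] [IsDomain S] [IsNoetherianRing S] [IsDomain R]
    [UniqueFactorizationMonoid R]
    (hdvd : ∀ a b : S, algebraMap S R a ∣ algebraMap S R b → a ∣ b)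
    (D : Type u) [AddCommGroup D] [Module S D] (hD : IsSemidualizing S D) :
    ∃ J : Ideal S, J ≠ ⊥ ∧ IsDivisorialIn R J ∧ Nonempty (D ≃ₗ[S] J) := by
  have := hD.finite
  have hhom := hD.homothety_bijective
  have hι := algebraMap_injective_of_dvd hdvd
  obtain ⟨f, hf, hf0⟩ := exists_injective_of_homothety_bijective hhom
  have hfaith : ∀ a : S, (∀ x : D, a • x = 0) → a = 0 := fun a ha =>
    (injective_iff_map_eq_zero _).1 hhom.1 a (LinearMap.ext ha)
  obtain ⟨d₀, hd₀⟩ : ∃ d, f d ≠ 0 := by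
    by_contra! h
    exact hf0 (LinearMap.ext h)
  set x := f d₀ with hx
  let J : Ideal S := LinearMap.range f
  obtain ⟨g, hg, hg'⟩ := exists_gcd_ideal (R := R) J
  have hg0 : g ≠ 0 := by
    rintro rfl
    exact hd₀ (hι (by rw [map_zero]; exact zero_dvd_iff.1 (hg _ ⟨d₀, rfl⟩)))
  -- `E` is the hull of `J` cut out by common divisors. To prove E = J, the quotient is embedded in
  -- D/xD by e ↦ e • d₀, and maps from `D` to it are shown to vanish.
  let E : Ideal S := (Ideal.span {g}).comap (algebraMap S R)
  have hE : ∀ e, e ∈ E ↔ g ∣ algebraMap S R e := fun e => by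
    rw [Ideal.mem_comap, Ideal.mem_span_singleton]
  have hJE : J ≤ E := fun j hj => (hE j).2 (hg j hj)
  let N : Submodule S E := Submodule.comap E.subtype J
  let P : Submodule S D := LinearMap.range (LinearMap.lsmul S D x)
  let μ₀ : E →ₗ[S] D ⧸ P := P.mkQ ∘ₗ (LinearMap.toSpanSingleton S D d₀) ∘ₗ E.subtype
  have hμ₀ : ∀ e : E, μ₀ e = P.mkQ ((e : S) • d₀) := fun _ => rfl
  have hker : LinearMap.ker μ₀ = N := by
    ext e
    rw [LinearMap.mem_ker, hμ₀, Submodule.mkQ_apply, Submodule.Quotient.mk_eq_zero]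
    constructor
    · rintro ⟨d, hd⟩
      refine ⟨d, ?_⟩
      have h := congrArg f hd
      rw [LinearMap.lsmul_apply, map_smul, map_smul, smul_eq_mul, smul_eq_mul, mul_comm] at h
      exact mul_right_cancel₀ hd₀ h
    · rintro ⟨d, hd⟩
      refine ⟨d, hf ?_⟩
      rw [LinearMap.lsmul_apply, map_smul, map_smul, hd, smul_eq_mul, smul_eq_mul, mul_comm]
      rfl
  let μ : (E ⧸ N) →ₗ[S] D ⧸ P := N.liftQ μ₀ hker.ge
  have hμ : Function.Injective μ := by
    rw [← LinearMap.ker_eq_bot]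
    exact Submodule.ker_liftQ_eq_bot _ _ _ hker.le
  have hsmul_inj : Function.Injective (LinearMap.lsmul S D x) := by
    rw [injective_iff_map_eq_zero]
    intro d hd
    apply hf
    have h := congrArg f hd
    rw [LinearMap.lsmul_apply, map_smul, map_zero, smul_eq_mul] at h
    rw [map_zero]
    exact (mul_eq_zero.1 h).resolve_left hd₀
  have hsub : Subsingleton (D →ₗ[S] (E ⧸ N)) := by
    suffices hall : ∀ h : D →ₗ[S] (E ⧸ N), h = 0 from ⟨fun a b => by rw [hall a, hall b]⟩
    intro h
    -- Ext¹(D, D) = 0 lifts the map into D/xD to an endomorphism of `D`, which is a homothety by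
    -- some `a`. Comparing gcds gives x ∣ a, so the map is zero.
    obtain ⟨γ, hγ⟩ := exists_lift_of_subsingleton_ext (hD.ext_subsingleton 1 one_pos)
      (LinearMap.lsmul S D x) P.mkQ hsmul_inj P.mkQ_surjective
      (LinearMap.exact_iff.2 P.ker_mkQ) (μ ∘ₗ h)
    obtain ⟨a, rfl⟩ := hhom.2 γ
    have hγ' : ∀ d, P.mkQ (a • d) = μ (h d) := fun d => LinearMap.congr_fun hγ d
    have hdiv : ∀ i ∈ J, algebraMap S R x * g ∣ algebraMap S R a * algebraMap S R i := by
      rintro _ ⟨d, rfl⟩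
      obtain ⟨e, he⟩ := N.mkQ_surjective (h d)
      have h1 := hγ' d
      rw [← he, show μ (N.mkQ e) = P.mkQ ((e : S) • d₀) from rfl, ← sub_eq_zero, ← map_sub,
        Submodule.mkQ_apply, Submodule.Quotient.mk_eq_zero] at h1
      obtain ⟨d', hd'⟩ := h1
      have h2 := congrArg f hd'
      rw [LinearMap.lsmul_apply, map_smul, map_sub, map_smul, map_smul, smul_eq_mul, smul_eq_mul,
        smul_eq_mul, ← hx] at h2
      have h3 : a * f d = x * (f d' + e) := by linear_combination -h2
      rw [← map_mul, h3, map_mul]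
      exact mul_dvd_mul_left _ ((hE _).1 (E.add_mem (hJE ⟨d', rfl⟩) e.2))
    obtain ⟨a', rfl⟩ := hdvd x a ((mul_dvd_mul_iff_right hg0).1 (hg' _ _ hdiv))
    ext d
    apply hμ
    rw [← hγ', mul_smul, LinearMap.zero_apply, map_zero, Submodule.mkQ_apply,
      Submodule.Quotient.mk_eq_zero]
    exact ⟨a' • d, rfl⟩
  have hEN := subsingleton_of_subsingleton_linearMap hfaith (E ⧸ N) hsub
  have hN : N = ⊤ := Submodule.Quotient.subsingleton_iff.1 hEN
  refine ⟨J, ?_, fun e he => ?_, ⟨LinearEquiv.ofInjective f hf⟩⟩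
  · intro h
    rw [LinearMap.range_eq_bot] at h
    exact hf0 h
  · have : (⟨e, (hE e).2 (he g hg)⟩ : E) ∈ N := hN ▸ Submodule.mem_top
    exact this

/-! ### Homomorphisms between ideals -/

section Hom

variable {I J : Ideal S}

/-- Evaluation at an element of an ideal identifies maps between ideals with elements of the
target. -/
def evalAt (J : Ideal S) (i₀ : I) : (I →ₗ[S] J) →ₗ[S] S := J.subtype ∘ₗ LinearMap.applyₗ i₀

theorem mul_apply_eq (i₀ : I) (φ : I →ₗ[S] J) (i : I) :
    (i₀ : S) * φ i = evalAt J i₀ φ * i := by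
  have h : (i₀ : S) • i = (i : S) • i₀ := Subtype.ext (mul_comm _ _)
  have h1 := congrArg (fun z : J => (z : S)) (congrArg φ h)
  simp only [map_smul, Submodule.coe_smul, smul_eq_mul] at h1
  rw [h1, mul_comm]
  rfl

theorem evalAt_injective [IsDomain S] {i₀ : I} (h0 : (i₀ : S) ≠ 0) :
    Function.Injective (evalAt J i₀) := by
  rw [injective_iff_map_eq_zero]
  intro φ hφ
  ext i
  have := mul_apply_eq i₀ φ i
  rw [hφ, zero_mul] at this
  exact (mul_eq_zero.1 this).resolve_left h0

theorem mem_range_evalAt [IsDomain S] {i₀ : I} (h0 : (i₀ : S) ≠ 0) {c : S}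
    (h : ∀ i ∈ I, ∃ δ ∈ J, c * i = i₀ * δ) : c ∈ LinearMap.range (evalAt J i₀) := by
  have h' : ∀ i : I, ∃ δ : J, c * i = i₀ * δ := fun i => by
    obtain ⟨δ, hδ, e⟩ := h i i.2
    exact ⟨⟨δ, hδ⟩, e⟩
  choose δ hδ using h'
  refine ⟨{ toFun := δ, map_add' := fun a b => Subtype.ext (mul_left_cancel₀ h0 ?_),
            map_smul' := fun s a => Subtype.ext (mul_left_cancel₀ h0 ?_) }, ?_⟩
  · rw [← hδ, Submodule.coe_add, Submodule.coe_add, mul_add, mul_add, hδ, hδ]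
  · rw [← hδ, RingHom.id_apply, Submodule.coe_smul, Submodule.coe_smul, smul_eq_mul, smul_eq_mul,
      mul_left_comm, hδ, mul_left_comm]
  · change (δ i₀ : S) = c
    apply mul_left_cancel₀ h0
    rw [← hδ, mul_comm]

/-- For a common divisor f of `J`, i₀f divides every φ(i₀)i, hence ig for the gcd g of the range,
hence ci. Taking f = 1 defines δ = ci/i₀, and general f puts δ in `J`. -/
theorem isDivisorialIn_range_evalAt [IsDomain S] [IsNoetherianRing S] [IsDomain R]
    [UniqueFactorizationMonoid R]
    (hdvd : ∀ a b : S, algebraMap S R a ∣ algebraMap S R b → a ∣ b) (hJ : IsDivisorialIn R J)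
    {i₀ : I} (h0 : (i₀ : S) ≠ 0) : IsDivisorialIn R (LinearMap.range (evalAt J i₀)) := by
  intro c hc
  obtain ⟨g, hg, hg'⟩ := exists_gcd_ideal (R := R) (LinearMap.range (evalAt J i₀))
  have hι0 : algebraMap S R i₀ ≠ 0 := fun h =>
    h0 (algebraMap_injective_of_dvd hdvd (by rw [h, map_zero]))
  refine mem_range_evalAt h0 fun i hi => ?_
  have key : ∀ f : R, (∀ j ∈ J, f ∣ algebraMap S R j) →
      algebraMap S R i₀ * f ∣ algebraMap S R (c * i) := by
    intro f hf
    have h1 : algebraMap S R i₀ * f ∣ algebraMap S R i * g := by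
      refine hg' _ _ ?_
      rintro _ ⟨φ, rfl⟩
      rw [← map_mul, mul_comm i, ← mul_apply_eq i₀ φ ⟨i, hi⟩, map_mul]
      exact mul_dvd_mul_left _ (hf _ (φ ⟨i, hi⟩).2)
    rw [map_mul, mul_comm (algebraMap S R c)]
    exact h1.trans (mul_dvd_mul_left _ (hc g hg))
  have h1 : algebraMap S R i₀ ∣ algebraMap S R (c * i) := by
    have := key 1 fun j _ => one_dvd _
    rwa [mul_one] at this
  obtain ⟨δ, hδ⟩ := hdvd _ _ h1
  refine ⟨δ, hJ δ fun f hf => ?_, hδ⟩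
  have := key f hf
  rw [hδ, map_mul] at this
  exact (mul_dvd_mul_iff_left hι0).1 this

/-- If the maps from a divisorial ideal `I` to `J` are the multiples of a single map, this map is an
isomorphism. -/
theorem linearEquiv_of_range_evalAt_eq_span [IsDomain S] (hI : IsDivisorial I) (hJ : J ≠ ⊥)
    {i₀ : I} (h0 : (i₀ : S) ≠ 0) {c : S}
    (hc : LinearMap.range (evalAt J i₀) = Ideal.span {c}) : Nonempty (I ≃ₗ[S] J) := by
  obtain ⟨φ, hφ⟩ : c ∈ LinearMap.range (evalAt J i₀) := hc ▸ Ideal.mem_span_singleton_self c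
  have hmem : ∀ w ∈ LinearMap.range (evalAt J i₀), ∃ s, w = s * c := fun w hw => by
    rw [hc, Ideal.mem_span_singleton'] at hw
    exact ⟨_, hw.choose_spec.symm⟩
  have hφi : ∀ i : I, (i₀ : S) * φ i = c * i := fun i => by rw [mul_apply_eq, hφ]
  have hc0 : c ≠ 0 := by
    rintro rfl
    obtain ⟨δ, hδ, hδ0⟩ := Submodule.exists_mem_ne_zero_of_ne_bot hJ
    obtain ⟨s, hs⟩ := hmem (i₀ * δ) (mem_range_evalAt h0 fun i _ =>
      ⟨i * δ, J.mul_mem_left _ hδ, by ring⟩)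
    rw [mul_zero] at hs
    exact mul_ne_zero h0 hδ0 hs
  refine ⟨LinearEquiv.ofBijective φ ⟨?_, fun δ => ?_⟩⟩
  · rw [injective_iff_map_eq_zero]
    intro i hi
    have h := hφi i
    rw [hi, Submodule.coe_zero, mul_zero] at h
    exact Subtype.ext ((mul_eq_zero.1 h.symm).resolve_left hc0)
  · obtain ⟨s, hs⟩ := hmem (i₀ * δ) (mem_range_evalAt h0 fun i _ =>
      ⟨i * δ, J.mul_mem_left _ δ.2, by ring⟩)
    -- Divisoriality is used here: if a divides bi for all i in `I`, then i ↦ (bi/a)δ maps `I` to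
    -- `J`, so it is a multiple s' of the generator, and as' = bs.
    have hsI : s ∈ I := by
      refine hI s fun a b ha hab => ?_
      obtain ⟨w, hw⟩ := hab i₀ i₀.2
      obtain ⟨s', hs'⟩ := hmem (w * δ) (mem_range_evalAt h0 fun i hi => by
        obtain ⟨v, hv⟩ := hab i hi
        refine ⟨v * δ, J.mul_mem_left _ δ.2, mul_left_cancel₀ ha ?_⟩
        linear_combination (↑i₀ : S) * (δ : S) * hv - i * (δ : S) * hw)
      refine ⟨s', mul_right_cancel₀ hc0 ?_⟩
      linear_combination a * hs' - b * hs + (δ : S) * hw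
    refine ⟨⟨s, hsI⟩, Subtype.ext (mul_left_cancel₀ h0 ?_)⟩
    rw [hφi, hs, mul_comm]

/-- A reflexive module `M` of rank one and its dual with respect to a semidualizing module `D` are
isomorphic to ideals cut out by common divisors; if the second one is principal, then `M ≃ D`. -/
theorem exists_isDivisorialIn_of_isTorsionFree {S : Type u} {R : Type*} [CommRing S] [CommRing R]
    [Algebra S R] [IsDomain S] [IsNoetherianRing S] [IsDomain R] [UniqueFactorizationMonoid R]
    (hdvd : ∀ a b : S, algebraMap S R a ∣ algebraMap S R b → a ∣ b)
    (M : Type u) [AddCommGroup M] [Module S M] [Module.IsReflexive S M] (hM : Module.rank S M = 1)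
    (D : Type u) [AddCommGroup D] [Module S D] (hD : IsSemidualizing S D)
    (htf : Module.IsTorsionFree S (M ⊗[S] (M →ₗ[S] D))) :
    ∃ I N : Ideal S, I ≠ ⊥ ∧ N ≠ ⊥ ∧ IsDivisorialIn R I ∧ IsDivisorialIn R N ∧
      Module.IsTorsionFree S (I ⊗[S] N) ∧ Module.IsTorsionFree S (N ⊗[S] I) ∧
      Nonempty (M ≃ₗ[S] I) ∧ ∀ c, N = Ideal.span {c} → Nonempty (M ≃ₗ[S] D) := by
  obtain ⟨I, hI0, hI, ⟨eM⟩⟩ := exists_isDivisorial_of_isReflexive M hM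
  obtain ⟨J, hJ0, hJ, ⟨eD⟩⟩ := exists_isDivisorialIn_of_ext hdvd D hD
  obtain ⟨i₀, hi₀, h0⟩ := Submodule.exists_mem_ne_zero_of_ne_bot hI0
  let eN := (eM.arrowCongr eD).trans
    (LinearEquiv.ofInjective _ (evalAt_injective (J := J) (i₀ := (⟨i₀, hi₀⟩ : I)) h0))
  let e := TensorProduct.congr eM eN
  have htf1 := Function.Injective.moduleIsTorsionFree e.symm e.symm.injective
    fun r m => map_smul e.symm r m
  let e' := TensorProduct.comm S I (LinearMap.range (evalAt J (⟨i₀, hi₀⟩ : I)))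
  have htf2 := Function.Injective.moduleIsTorsionFree e'.symm e'.symm.injective
    fun r m => map_smul e'.symm r m
  refine ⟨I, LinearMap.range (evalAt J (⟨i₀, hi₀⟩ : I)), hI0, ?_, hI.isDivisorialIn hdvd,
    isDivisorialIn_range_evalAt hdvd hJ h0, htf1, htf2, ⟨eM⟩, fun c hc => ?_⟩
  · obtain ⟨δ, hδ, hδ0⟩ := Submodule.exists_mem_ne_zero_of_ne_bot hJ0
    have hmem : i₀ * δ ∈ LinearMap.range (evalAt J (⟨i₀, hi₀⟩ : I)) :=
      mem_range_evalAt h0 fun i _ => ⟨i * δ, J.mul_mem_left _ hδ, by ring⟩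
    intro h
    rw [h] at hmem
    exact mul_ne_zero h0 hδ0 hmem
  · obtain ⟨e''⟩ := linearEquiv_of_range_evalAt_eq_span hI hJ0 h0 hc
    exact ⟨(eM.trans e'').trans eD.symm⟩

end Hom

end Divisorial

/-! ### Rank one modules over the invariant ring -/

namespace MvPowerSeries

section Rank1

variable {σ k : Type*} [Field k]
  {τ : MvPowerSeries σ k ≃ₐ[k] MvPowerSeries σ k} {S : Subalgebra k (MvPowerSeries σ k)}

/-- The greatest common divisor of an ideal of invariants can be chosen semi-invariant. -/
theorem exists_semiinvariant_gcd [Finite σ] [UniqueFactorizationMonoid (MvPowerSeries σ k)]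
    (hS : ∀ x, x ∈ S ↔ τ x = x) {q : ℕ} (hτ : τ ^ q = 1) (hq : (q : k) ≠ 0) {I : Ideal S}
    (hI0 : I ≠ ⊥) (hI : IsDivisorialIn (MvPowerSeries σ k) I) :
    ∃ (a : k) (f : MvPowerSeries σ k), f ≠ 0 ∧ a ^ q = 1 ∧ τ f = a • f ∧
      ∀ e : S, e ∈ I ↔ f ∣ e := by
  have := isNoetherianRing_invariants hS hτ hq
  obtain ⟨g, hg, hg'⟩ := exists_gcd_ideal (R := MvPowerSeries σ k) I
  have hg0 : g ≠ 0 := by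
    rintro rfl
    obtain ⟨i, hi, hi0⟩ := Submodule.exists_mem_ne_zero_of_ne_bot hI0
    exact hi0 (Subtype.ext (zero_dvd_iff.1 (hg i hi)))
  -- Elements of `I` are invariant, so the inverse image of `g` under `τ` is again a common divisor
  -- and divides `g`.
  obtain ⟨c, hc⟩ : g ∣ τ g := by
    have h := hg' (τ.symm g) 1 fun i hi => by
      have h1 : τ.symm (i : MvPowerSeries σ k) = i := by
        rw [AlgEquiv.symm_apply_eq, (hS _).1 i.2]
      rw [one_mul]
      have h2 := map_dvd τ.symm (hg i hi)
      rwa [show algebraMap S (MvPowerSeries σ k) i = (i : MvPowerSeries σ k) from rfl, h1] at h2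
    rw [one_mul] at h
    have h3 := map_dvd τ h
    rwa [AlgEquiv.apply_symm_apply] at h3
  set a := constantCoeff c
  have hcj : ∀ j : ℕ, ∃ cj, (τ ^ j) g = g * cj ∧ constantCoeff cj = a ^ j := by
    intro j
    induction j with
    | zero => exact ⟨1, by simp, by simp⟩
    | succ j ih =>
      obtain ⟨cj, h1, h2⟩ := ih
      refine ⟨c * τ cj, ?_, ?_⟩
      · rw [pow_succ', AlgEquiv.mul_apply, h1, map_mul, hc, mul_assoc]
      · rw [map_mul, constantCoeff_algEquiv, h2, pow_succ']
  choose cj hcj1 hcj2 using hcj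
  have ha : a ^ q = 1 := by
    have h := hcj1 q
    rw [hτ, AlgEquiv.one_apply] at h
    have h1 : cj q = 1 := mul_left_cancel₀ hg0 (by rw [← h, mul_one])
    rw [← hcj2, h1, map_one]
  have ha0 : a ≠ 0 := by
    intro h
    rw [h, zero_pow (by rintro rfl; simp at hq)] at ha
    exact zero_ne_one ha
  -- The twisted average of `g` is `g * w`, and `w` is a unit because its constant term is `q`; so
  -- the gcd may be replaced by a semi-invariant.
  let w : MvPowerSeries σ k := ∑ j ∈ Finset.range q, (a⁻¹) ^ j • cj j
  have hw : IsUnit w := by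
    rw [isUnit_iff_constantCoeff, isUnit_iff_ne_zero]
    simp only [w, map_sum, constantCoeff_smul, hcj2, smul_eq_mul]
    have : ∀ j ∈ Finset.range q, a⁻¹ ^ j * a ^ j = 1 := fun j _ => by
      rw [← mul_pow, inv_mul_cancel₀ ha0, one_pow]
    rw [Finset.sum_congr rfl this]
    simpa using hq
  have hgw : ∑ j ∈ Finset.range q, (a⁻¹) ^ j • (τ ^ j) g = g * w := by
    simp only [w, hcj1, Finset.mul_sum, mul_smul_comm]
  have hdvd : ∀ e, g * w ∣ e ↔ g ∣ e := fun e => hw.mul_right_dvd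
  refine ⟨a, g * w, mul_ne_zero hg0 hw.ne_zero, ha, ?_, fun e => ?_⟩
  · rw [← hgw]
    exact algEquiv_twisted_sum hτ ha g
  · rw [hdvd]
    refine ⟨fun he => hg e he, fun he => hI e fun f hf => ?_⟩
    have h := hg' f 1 fun i hi => by
      rw [one_mul]
      exact hf i hi
    rw [one_mul] at h
    exact h.trans he

/-- If `I` and `J` are cut out by semi-invariants and `I ⊗ J` is torsion-free, then `I` is principal
as soon as suitable semi-invariants multiply to a minimal generator. -/
theorem exists_eq_span_singleton (hS : ∀ x, x ∈ S ↔ τ x = x) [IsLocalRing S] [IsNoetherianRing S]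
    {I J : Ideal S} (htf : Module.IsTorsionFree S (I ⊗[S] J)) {a b : k} (ha : a ≠ 0) (hb : b ≠ 0)
    {f g : MvPowerSeries σ k} (hf0 : f ≠ 0) (hg0 : g ≠ 0) (hf : τ f = a • f) (hg : τ g = b • g)
    (hI : ∀ e : S, e ∈ I ↔ f ∣ e) (hJ : ∀ e : S, e ∈ J ↔ g ∣ e) {u v : MvPowerSeries σ k}
    (hu : τ u = a⁻¹ • u) (hv : τ v = (b⁻¹ / a⁻¹) • v)
    (huv : u * v ∉ Ideal.span {s | τ s = s ∧ constantCoeff s = 0}) :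
    ∃ x, I = Ideal.span {x} := by
  have hX : τ (f * u) = f * u := by
    rw [map_mul, hf, hu, smul_mul_smul_comm, mul_inv_cancel₀ ha, one_smul]
  have hW : τ (g * (u * v)) = g * (u * v) := by
    rw [map_mul, map_mul, hg, hu, hv, smul_mul_smul_comm, smul_mul_smul_comm]
    rw [show b * (a⁻¹ * (b⁻¹ / a⁻¹)) = 1 by field_simp, one_smul]
  let X : I := ⟨⟨f * u, (hS _).2 hX⟩, (hI _).2 (Dvd.intro _ rfl)⟩
  let W : J := ⟨⟨g * (u * v), (hS _).2 hW⟩, (hJ _).2 (Dvd.intro _ rfl)⟩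
  refine ⟨_, eq_span_of_isTorsionFree_tensor I J htf X W (fun hmem => huv ?_) fun Y => ?_⟩
  -- Dividing by `g`, membership of `W` in 𝔪J would put `u * v` in the ideal generated by nonunit
  -- invariants.
  · have key : ∀ z ∈ IsLocalRing.maximalIdeal S * J,
        ∃ w ∈ Ideal.span {s | τ s = s ∧ constantCoeff s = 0},
          (z : MvPowerSeries σ k) = g * w := by
      intro z hz
      induction hz using Submodule.mul_induction_on' with
      | mem_mul_mem s hs j hj =>
        obtain ⟨j', hj'⟩ := (hJ j).1 hj
        refine ⟨s * j', Ideal.mul_mem_right _ _ (Ideal.subset_span ⟨(hS _).1 s.2, ?_⟩), ?_⟩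
        · by_contra hs0
          exact hs (isUnit_invariants_of_constantCoeff_ne_zero hS hs0)
        · change (s : MvPowerSeries σ k) * (j : MvPowerSeries σ k) = _
          rw [hj']
          ring
      | add x _ y _ hx hy =>
        obtain ⟨w₁, h₁, e₁⟩ := hx
        obtain ⟨w₂, h₂, e₂⟩ := hy
        refine ⟨w₁ + w₂, Ideal.add_mem _ h₁ h₂, ?_⟩
        change (x : MvPowerSeries σ k) + (y : MvPowerSeries σ k) = _
        rw [e₁, e₂, mul_add]
    obtain ⟨w, hw, e⟩ := key _ hmem
    rw [mul_left_cancel₀ hg0 (show g * (u * v) = g * w from e)]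
    exact hw
  · obtain ⟨y, hy⟩ := (hI Y).1 Y.2
    have hτy : τ y = a⁻¹ • y := by
      have h := (hS _).1 (Y : S).2
      rw [hy, map_mul, hf, smul_mul_assoc, ← mul_smul_comm] at h
      rw [eq_inv_smul_iff₀ ha]
      exact mul_left_cancel₀ hf0 h
    have hZ : τ (g * (y * v)) = g * (y * v) := by
      rw [map_mul, map_mul, hg, hτy, hv, smul_mul_smul_comm, smul_mul_smul_comm]
      rw [show b * (a⁻¹ * (b⁻¹ / a⁻¹)) = 1 by field_simp, one_smul]
    refine ⟨⟨⟨g * (y * v), (hS _).2 hZ⟩, (hJ _).2 (Dvd.intro _ rfl)⟩, Subtype.ext ?_⟩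
    change f * u * (g * (y * v)) = (Y : MvPowerSeries σ k) * (g * (u * v))
    rw [hy]
    ring

end Rank1

/-- The rank one case of the torsion-freeness problem for `M ⊗ Hom(M, D)` over the invariant ring of
an automorphism of prime power order. -/
theorem linearEquiv_self_or_of_isTorsionFree {k : Type u} [Field k] {d p r : ℕ} (hp : p.Prime)
    (hpk : (p : k) ≠ 0) (τ : MvPowerSeries (Fin d) k ≃ₐ[k] MvPowerSeries (Fin d) k)
    (hτ : orderOf τ = p ^ r) {S : Subalgebra k (MvPowerSeries (Fin d) k)}
    (hS : ∀ x, x ∈ S ↔ τ x = x) (D : Type u) [AddCommGroup D] [Module S D]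
    (hD : IsSemidualizing S D) (M : Type u) [AddCommGroup M] [Module S M]
    [Module.IsReflexive S M] (hM : Module.rank S M = 1)
    (htf : Module.IsTorsionFree S (M ⊗[S] (M →ₗ[S] D))) :
    Nonempty (M ≃ₗ[S] S) ∨ Nonempty (M ≃ₗ[S] D) := by
  have hq : ((p ^ r : ℕ) : k) ≠ 0 := by
    rw [Nat.cast_pow]
    exact pow_ne_zero _ hpk
  have hτ1 : τ ^ p ^ r = 1 := by rw [← hτ, pow_orderOf_eq_one]
  have := isNoetherianRing_invariants hS hτ1 hq
  have := isLocalRing_invariants hS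
  have hdvd : ∀ a b : S, algebraMap S (MvPowerSeries (Fin d) k) a ∣
      algebraMap S (MvPowerSeries (Fin d) k) b → a ∣ b := fun a b h => dvd_of_dvd_invariants hS h
  obtain ⟨I, N, hI0, hN0, hI, hN, htf1, htf2, ⟨eM⟩, hND⟩ :=
    exists_isDivisorialIn_of_isTorsionFree hdvd M hM D hD htf
  obtain ⟨a, f, hf0, ha, hf, hIf⟩ := exists_semiinvariant_gcd hS hτ1 hq hI0 hI
  obtain ⟨b, g, hg0, hb, hg, hNg⟩ := exists_semiinvariant_gcd hS hτ1 hq hN0 hN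
  have hne : ∀ {c : k}, c ^ p ^ r = 1 → c ≠ 0 := fun {c} hc h => by
    rw [h, zero_pow (pow_ne_zero _ hp.ne_zero)] at hc
    exact zero_ne_one hc
  -- The weights are inverted because an invariant multiple of `f` has a cofactor of weight a⁻¹.
  rcases exists_semiinvariants_mul_notMem hp hpk τ hτ (a := a⁻¹) (b := b⁻¹)
    (by rw [inv_pow, ha, inv_one]) (by rw [inv_pow, hb, inv_one]) with
    ⟨u, v, hu, hv, huv⟩ | ⟨u, v, hu, hv, huv⟩
  · left
    obtain ⟨x, rfl⟩ := exists_eq_span_singleton hS htf1 (hne ha) (hne hb) hf0 hg0 hf hg hIf hNg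
      hu hv huv
    have hx : x ≠ 0 := by
      rintro rfl
      simp at hI0
    exact ⟨eM.trans (LinearEquiv.toSpanNonzeroSingleton S S x hx).symm⟩
  · right
    obtain ⟨c, hc⟩ := exists_eq_span_singleton hS htf2 (hne hb) (hne ha) hg0 hf0 hg hf hNg hIf
      hu hv huv
    exact hND c hc

end MvPowerSeries

theorem corollary4p5 (k : Type u) [Field k] (d : ℕ) (p l : ℕ) (hp : p.Prime)
    (hkp : ringChar k ≠ p)
    (G : Type v) [Group G] [IsCyclic G] (hG : Nat.card G = p ^ l)
    [MulSemiringAction G (MvPowerSeries (Fin d) k)]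
    [SMulCommClass G k (MvPowerSeries (Fin d) k)]
    (D : Type u) [AddCommGroup D] [Module (powerSeriesInvariants k d G) D]
    (hD : IsDualizing (powerSeriesInvariants k d G) D)
    (M : Type u) [AddCommGroup M] [Module (powerSeriesInvariants k d G) M]
    [Module.IsReflexive (powerSeriesInvariants k d G) M]
    (hM : Module.rank (powerSeriesInvariants k d G) M = 1)
    (htf : Module.IsTorsionFree (powerSeriesInvariants k d G)
      (M ⊗[powerSeriesInvariants k d G] (M →ₗ[powerSeriesInvariants k d G] D))) :
    Nonempty (M ≃ₗ[powerSeriesInvariants k d G] (powerSeriesInvariants k d G)) ∨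
      Nonempty (M ≃ₗ[powerSeriesInvariants k d G] D) := by
  obtain ⟨γ, hγ⟩ := IsCyclic.exists_generator (α := G)
  have hpk : (p : k) ≠ 0 := by
    intro h
    rcases (Nat.dvd_prime hp).1 (ringChar.dvd h) with h1 | h1
    · exact CharP.ringChar_ne_one h1
    · exact hkp h1
  let act : G →* (MvPowerSeries (Fin d) k ≃ₐ[k] MvPowerSeries (Fin d) k) :=
    MulSemiringAction.toAlgAut G k (MvPowerSeries (Fin d) k)
  have hact : ∀ g x, act g x = g • x := fun _ _ => rfl
  have hpow : act γ ^ p ^ l = 1 := by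
    rw [← map_pow, ← hG, pow_card_eq_one', map_one]
  -- The action need not be faithful, so the order of the generator's image is only some divisor p^r
  -- of p^l.
  obtain ⟨r, -, hr⟩ := (Nat.dvd_prime_pow hp).1 (orderOf_dvd_of_pow_eq_one hpow)
  have hS : ∀ x, x ∈ powerSeriesInvariants k d G ↔ act γ x = x := by
    intro x
    refine ⟨fun h => h γ, fun h g => ?_⟩
    have hle : Subgroup.zpowers γ ≤ MulAction.stabilizer G x := by
      rw [Subgroup.zpowers_le]
      exact h
    exact hle (hγ g)
  exact MvPowerSeries.linearEquiv_self_or_of_isTorsionFree hp hpk (act γ) hr hS D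
    hD.toIsSemidualizing M hM htf
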